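/- Let $F$ be a non-Archimedean, non-discrete locally compact field with valuation ring $\mathfrak o$, maximal ideal $\mathfrak p$ and residue field $\mathbf k=\mathfrak o/\mathfrak p$, and assume that the characteristic of $\mathbf k$ is not $2$. Let $G=\mathrm{PGL}(2,F)$ with its quotient topology from $\mathrm{GL}(2,F)$. Let $X$ be the Bruhat–Tits tree of $G$: its vertices are the homothety classes $[L]$ of full $\mathfrak o$-lattices $L\subset F^2$, and $[L],[M]$ form an edge if and only if there is a basis $(e_1,e_2)$ of $F^2$ such that, up to homothety, $L=\mathfrak o e_1\oplus\mathfrak o e_2$ and $M=\mathfrak o e_1\oplus\mathfrak p e_2$. Let $\tilde X_0$ be the directed graph with the same vertices as $X$ and whose edges are the oriented edges $[s,t]$ of $X$ (so each edge $\{s,t\}$ of $X$ gives two distinct edges $[s,t]$ and $[t,s]$ of $\tilde X_0$); $G$ acts on it. Let $C_c^0(\tilde X_0)$ and $C_c^{1}(\tilde X_0)$ be the $G$-modules of finitely supported complex-valued functions on the vertices, respectively on the edges, of $\tilde X_0$, let $d:C_c^0(\tilde X_0)\to C_c^{1}(\tilde X_0)$ be given by $df([s,t])=f(t)-f(s)$,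 and put $H^1_c(\tilde X_0)=C_c^{1}(\tilde X_0)/d\,C_c^0(\tilde X_0)$. Let $B\subset G$ be the image of the group of upper triangular matrices, and let $\mathrm{St}_G$ be the Steinberg representation of $G$, that is, the quotient of the smooth induced representation $\mathrm{Ind}_B^G\mathbf 1$ (complex functions on $G$ that are left $B$-invariant and right invariant under some open subgroup, with $G$ acting by right translation) by the constant functions. Let $I\subset G$ be the standard Iwahori subgroup, the image of the group of matrices in $\mathrm{GL}(2,\mathfrak o)$ that are upper triangular modulo $\mathfrak p$, let $\tilde I$ be the normalizer of $I$ in $G$, and let $\mathrm{c\text{-}Ind}_{\tilde I}^G\mathbf 1$ be the compactly induced representation of the trivial character of $\tilde I$ (complex functions on $G$ that are left $\tilde I$-invariant, right invariant under some open subgroup, and supported in $\tilde I C$ for some compact $C\subset G$, with $G$ acting by right translation). Then there is an isomorphism of $G$-modules $$H^1_c(\tilde X_0)\;\cong\;\mathrm{St}_G\oplus \mathrm{c\text{-}Ind}_{\tilde I}^G\mathbf 1 .$$ -/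

import Mathlib

open scoped MatrixGroups ValuativeRel Pointwise

noncomputable section

namespace TreeCohomology

/-! ### Smooth induction and compact induction of complex representations -/

section Induction

/-- The right translation action `(g f)(x) = f (x * g)` of `G` on all functions `G → W`. -/
def rightTranslation (G W : Type*) [Group G] [AddCommGroup W] [Module ℂ W] :
    Representation ℂ G (G → W) where
  toFun g := LinearMap.funLeft ℂ W (· * g)
  map_one' := by
    ext f x
    simp [LinearMap.funLeft]
  map_mul' g h := by
    ext f x
    simp [LinearMap.funLeft, mul_assoc]

variable {G : Type*} [Group G] [TopologicalSpace G] [IsTopologicalGroup G] (H : Subgroup G)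
  {W : Type*} [AddCommGroup W] [Module ℂ W] (σ : Representation ℂ H W)

/-- The smooth induced representation `Ind_H^G σ`: functions `f : G → W` with
`f (h * g) = σ h (f g)` for `h ∈ H` that are right invariant under some open subgroup of `G`.
The group `G` acts by right translation. -/
def smoothInd : Subrepresentation (rightTranslation G W) where
  toSubmodule :=
    { carrier := {f | (∀ (h : H) (g : G), f (h * g) = σ h (f g)) ∧
        ∃ U : Subgroup G, IsOpen (U : Set G) ∧ ∀ g : G, ∀ u ∈ U, f (g * u) = f g}
      zero_mem' := ⟨fun h _ => (map_zero (σ h)).symm, ⊤, isOpen_univ, fun _ _ _ => rfl⟩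
      add_mem' := by
        rintro f f' ⟨hf, U, hU, h⟩ ⟨hf', U', hU', h'⟩
        refine ⟨fun a g => by simp [hf, hf'], U ⊓ U', hU.inter hU', fun g u hu => ?_⟩
        change f (g * u) + f' (g * u) = f g + f' g
        rw [h g u hu.1, h' g u hu.2]
      smul_mem' := by
        rintro c f ⟨hf, U, hU, h⟩
        refine ⟨fun a g => by simp [hf], U, hU, fun g u hu => ?_⟩
        change c • f (g * u) = c • f g
        rw [h g u hu] }
  apply_mem_toSubmodule := by
    rintro x f ⟨hf, U, hU, h⟩
    refine ⟨fun a g => ?_, U.comap (MulAut.conj x⁻¹).toMonoidHom, ?_, fun g u hu => ?_⟩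
    · change f (a * g * x) = σ a (f (g * x))
      rw [mul_assoc, hf]
    · refine hU.preimage ?_
      change Continuous fun u : G => x⁻¹ * u * x⁻¹⁻¹
      fun_prop
    · change f (g * u * x) = f (g * x)
      have hu' : x⁻¹ * u * x⁻¹⁻¹ ∈ U := hu
      rw [← h (g * x) _ hu']
      group

/-- The compactly induced representation `c-Ind_H^G σ`: the functions in `Ind_H^G σ` whose support
is compact modulo `H`, i.e. contained in `H * C` for some compact subset `C` of `G`. -/
def cInd : Subrepresentation (rightTranslation G W) where
  toSubmodule := (smoothInd H σ).toSubmodule ⊓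
    { carrier := {f | ∃ C : Set G, IsCompact C ∧ Function.support f ⊆ (H : Set G) * C}
      zero_mem' := ⟨∅, isCompact_empty, fun g hg => absurd rfl hg⟩
      add_mem' := by
        rintro f f' ⟨C, hC, h⟩ ⟨C', hC', h'⟩
        refine ⟨C ∪ C', hC.union hC', ?_⟩
        rw [Set.mul_union]
        exact (Function.support_add f f').trans (Set.union_subset_union h h')
      smul_mem' := by
        rintro c f ⟨C, hC, h⟩
        exact ⟨C, hC, (Function.support_const_smul_subset c f).trans h⟩ }
  apply_mem_toSubmodule := by
    rintro x f ⟨hf, C, hC, h⟩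
    refine ⟨(smoothInd H σ).apply_mem_toSubmodule x hf, C * {x⁻¹}, hC.mul isCompact_singleton, ?_⟩
    intro g hg
    obtain ⟨a, ha, c, hc, hac⟩ := h (show g * x ∈ Function.support f from hg)
    refine ⟨a, ha, c * x⁻¹, Set.mul_mem_mul hc rfl, ?_⟩
    change a * (c * x⁻¹) = g
    rw [← mul_assoc, show a * c = g * x from hac, mul_inv_cancel_right]

end Induction

/-! ### Permutation representations on finitely supported functions -/

/-- The representation of `G` on the finitely supported functions on a `G`-set `S`,
`(g f)(s) = f (g⁻¹ s)`. -/
def permRep (G S : Type*) [Group G] [MulAction G S] : Representation ℂ G (S →₀ ℂ) where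
  toFun g := (Finsupp.domLCongr (MulAction.toPerm g)).toLinearMap
  map_one' := by
    ext s t
    simp [Finsupp.domLCongr]
  map_mul' g h := by
    ext s t
    simp [Finsupp.domLCongr, mul_smul]

theorem permRep_apply {G S : Type*} [Group G] [MulAction G S] (g : G) (f : S →₀ ℂ) (s : S) :
    permRep G S g f s = f (g⁻¹ • s) := rfl

/-! ### Subgroups of `PGL(2, F)` -/

/-- The subgroup of upper triangular matrices in `GL(2, R)`. -/
def upperTriangular (R : Type*) [CommRing R] : Subgroup (GL (Fin 2) R) where
  carrier := {g | g 1 0 = 0}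
  one_mem' := by simp
  mul_mem' := by
    intro a b ha hb
    have ha' : (a : Matrix (Fin 2) (Fin 2) R) 1 0 = 0 := ha
    have hb' : (b : Matrix (Fin 2) (Fin 2) R) 1 0 = 0 := hb
    change ((a * b : GL (Fin 2) R) : Matrix (Fin 2) (Fin 2) R) 1 0 = 0
    simp [Matrix.mul_apply, ha', hb']
  inv_mem' := by
    intro a ha
    have ha' : (a : Matrix (Fin 2) (Fin 2) R) 1 0 = 0 := ha
    change ((a⁻¹ : GL (Fin 2) R) : Matrix (Fin 2) (Fin 2) R) 1 0 = 0
    rw [Matrix.coe_units_inv, Matrix.inv_def, Matrix.adjugate_fin_two]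
    simp [ha']

section LocalField

variable (F : Type*) [Field F] [ValuativeRel F] [TopologicalSpace F]
  [IsNonarchimedeanLocalField F]

/-- The quotient topology on `PGL(2, F) = GL(2, F) / center`. -/
instance : TopologicalSpace PGL(2, F) :=
  inferInstanceAs (TopologicalSpace (GL (Fin 2) F ⧸ Subgroup.center (GL (Fin 2) F)))

instance : IsTopologicalGroup PGL(2, F) :=
  inferInstanceAs (IsTopologicalGroup (GL (Fin 2) F ⧸ Subgroup.center (GL (Fin 2) F)))

/-- The standard Borel subgroup of `PGL(2, F)`: the image of the upper triangular matrices. -/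
def borel : Subgroup PGL(2, F) :=
  (upperTriangular F).map Matrix.ProjGenLinGroup.mk

/-- The standard Iwahori subgroup of `PGL(2, F)`: the image of the group of matrices in `GL(2, 𝒪)`
that are upper triangular modulo the maximal ideal. -/
def iwahori : Subgroup PGL(2, F) :=
  (((upperTriangular 𝓀[F]).comap
    (Matrix.GeneralLinearGroup.map (IsLocalRing.residue 𝒪[F]))).map
      (Matrix.GeneralLinearGroup.map (algebraMap 𝒪[F] F))).map Matrix.ProjGenLinGroup.mk

/-- The normalizer of the standard Iwahori subgroup in `PGL(2, F)`. -/
def iwahoriNormalizer : Subgroup PGL(2, F) :=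
  Subgroup.normalizer (iwahori F : Set PGL(2, F))

/-! ### The Steinberg representation -/

/-- The smooth representation `Ind_B^G 𝟏` of `G = PGL(2, F)`. -/
abbrev borelInd :
    Subrepresentation (rightTranslation PGL(2, F) ℂ) :=
  smoothInd (borel F) (Representation.trivial ℂ (borel F) ℂ)

/-- The line of constant functions in `Ind_B^G 𝟏`. -/
def constants : Submodule ℂ (borelInd F).toSubmodule where
  carrier := {f | ∃ c : ℂ, ∀ g, f.1 g = c}
  zero_mem' := ⟨0, fun _ => rfl⟩
  add_mem' := by
    rintro f f' ⟨c, h⟩ ⟨c', h'⟩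
    refine ⟨c + c', fun g => ?_⟩
    change f.1 g + f'.1 g = c + c'
    rw [h, h']
  smul_mem' := by
    rintro a f ⟨c, h⟩
    refine ⟨a • c, fun g => ?_⟩
    change a • f.1 g = a • c
    rw [h]

/-- The Steinberg representation of `G = PGL(2, F)`: the quotient of `Ind_B^G 𝟏` by the constant
functions. -/
def steinberg : Representation ℂ PGL(2, F) ((borelInd F).toSubmodule ⧸ constants F) :=
  (borelInd F).toRepresentation.quotient (constants F) (by
    rintro x f ⟨c, h⟩
    exact ⟨c, fun g => h (g * x)⟩)

end LocalField

/-! ### The Bruhat-Tits tree -/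

section Tree

variable (F : Type*) [Field F] [ValuativeRel F]

/-- Full `𝒪`-lattices in `F²`. -/
def FullLattice : Type _ := {L : Submodule 𝒪[F] (Fin 2 → F) // L.IsLattice F}

variable {F}

/-- The image `g L` of an `𝒪`-submodule `L` of `F²` under `v ↦ g *ᵥ v`. -/
def mapLattice (g : GL (Fin 2) F) (L : Submodule 𝒪[F] (Fin 2 → F)) :
    Submodule 𝒪[F] (Fin 2 → F) :=
  L.map ((Matrix.mulVecLin (g : Matrix (Fin 2) (Fin 2) F)).restrictScalars 𝒪[F])

theorem mem_mapLattice {g : GL (Fin 2) F} {L : Submodule 𝒪[F] (Fin 2 → F)} {x : Fin 2 → F} :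
    x ∈ mapLattice g L ↔ ∃ y ∈ L, (g : Matrix (Fin 2) (Fin 2) F).mulVec y = x := Iff.rfl

theorem isLattice_mapLattice (g : GL (Fin 2) F) {L : Submodule 𝒪[F] (Fin 2 → F)}
    (hL : L.IsLattice F) : (mapLattice g L).IsLattice F where
  fg := hL.fg.map _
  span_eq_top := by
    change Submodule.span F (Matrix.mulVecLin (g : Matrix (Fin 2) (Fin 2) F) '' (L : Set _)) = ⊤
    rw [← Submodule.map_span, hL.span_eq_top, Submodule.map_top, LinearMap.range_eq_top]
    intro x
    exact ⟨((g⁻¹ : GL (Fin 2) F) : Matrix (Fin 2) (Fin 2) F).mulVec x, by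
      rw [Matrix.mulVecLin_apply, Matrix.mulVec_mulVec, ← Units.val_mul]
      simp⟩

/-- `Fˣ` acts on lattices by homotheties. -/
instance : MulAction Fˣ (FullLattice F) where
  smul c L := ⟨c • L.1, @Submodule.IsLattice.smul _ _ F _ _ _ _ _ _ _ L.1 L.2 c⟩
  one_smul L := Subtype.ext (one_smul _ L.1)
  mul_smul c d L := Subtype.ext (mul_smul c d L.1)

theorem mem_homothety {c : Fˣ} {L : FullLattice F} {x : Fin 2 → F} :
    x ∈ (c • L).1 ↔ ∃ y ∈ L.1, c • y = x := Iff.rfl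

/-- `GL(2, F)` acts on lattices through its action on column vectors in `F²`. -/
instance : MulAction (GL (Fin 2) F) (FullLattice F) where
  smul g L := ⟨mapLattice g L.1, isLattice_mapLattice g L.2⟩
  one_smul L := by
    apply Subtype.ext
    change mapLattice 1 L.1 = L.1
    ext x
    simp [mem_mapLattice]
  mul_smul g h L := by
    apply Subtype.ext
    change mapLattice (g * h) L.1 = mapLattice g (mapLattice h L.1)
    ext x
    simp only [mem_mapLattice, Units.val_mul, ← Matrix.mulVec_mulVec]
    constructor
    · rintro ⟨y, hy, rfl⟩
      exact ⟨_, ⟨y, hy, rfl⟩, rfl⟩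
    · rintro ⟨_, ⟨y, hy, rfl⟩, rfl⟩
      exact ⟨y, hy, rfl⟩

theorem mem_smul_lattice {g : GL (Fin 2) F} {L : FullLattice F} {x : Fin 2 → F} :
    x ∈ (g • L).1 ↔ ∃ y ∈ L.1, (g : Matrix (Fin 2) (Fin 2) F).mulVec y = x := Iff.rfl

instance : SMulCommClass (GL (Fin 2) F) Fˣ (FullLattice F) where
  smul_comm g c L := by
    apply Subtype.ext
    ext x
    simp only [mem_smul_lattice, mem_homothety]
    constructor
    · rintro ⟨_, ⟨y, hy, rfl⟩, rfl⟩
      exact ⟨_, ⟨y, hy, rfl⟩, (Matrix.mulVec_smul _ c y).symm⟩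
    · rintro ⟨_, ⟨y, hy, rfl⟩, rfl⟩
      exact ⟨_, ⟨y, hy, rfl⟩, Matrix.mulVec_smul _ c y⟩

variable (F) in
/-- The vertices of the tree: homothety classes `[L]` of full lattices in `F²`. -/
def Vertex : Type _ := MulAction.orbitRel.Quotient Fˣ (FullLattice F)

/-- The homothety class `[L]` of a lattice. -/
def FullLattice.toVertex (L : FullLattice F) : Vertex F :=
  Quotient.mk (MulAction.orbitRel Fˣ (FullLattice F)) L

theorem FullLattice.toVertex_eq_iff {L M : FullLattice F} :
    L.toVertex = M.toVertex ↔ ∃ c : Fˣ, c • M = L :=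
  Quotient.eq (r := MulAction.orbitRel Fˣ (FullLattice F))

theorem Vertex.exists_rep (v : Vertex F) : ∃ L : FullLattice F, L.toVertex = v :=
  Quotient.exists_rep v

instance : MulAction (GL (Fin 2) F) (Vertex F) where
  smul g := Quotient.map (g • ·) (by
    rintro L M ⟨c, hc⟩
    exact ⟨c, by
      change c • M = L at hc
      change c • g • M = g • L
      rw [← smul_comm, hc]⟩)
  one_smul := by
    rintro ⟨L⟩
    exact congrArg FullLattice.toVertex (one_smul _ L)
  mul_smul := by
    rintro g h ⟨L⟩
    exact congrArg FullLattice.toVertex (mul_smul g h L)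

theorem smul_toVertex (g : GL (Fin 2) F) (L : FullLattice F) :
    g • L.toVertex = (g • L).toVertex := rfl

/-- The action of `PGL(2, F)` on the vertices, `g [L] = [g L]`. -/
instance : MulAction PGL(2, F) (Vertex F) :=
  Matrix.ProjGenLinGroup.mulActionOfGL (by
    intro c v
    obtain ⟨L, rfl⟩ := v.exists_rep
    rw [smul_toVertex, FullLattice.toVertex_eq_iff]
    refine ⟨c, Subtype.ext ?_⟩
    have h : ∀ x : Fin 2 → F, (Matrix.GeneralLinearGroup.scalar (Fin 2) c :
        Matrix (Fin 2) (Fin 2) F).mulVec x = c • x := by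
      intro x
      ext i
      simp [Units.smul_def]
    ext x
    simp only [mem_smul_lattice, mem_homothety, h])

theorem mk_smul_toVertex (g : GL (Fin 2) F) (L : FullLattice F) :
    (Matrix.ProjGenLinGroup.mk g : PGL(2, F)) • L.toVertex = (g • L).toVertex := rfl

/-- `v` and `w` form an edge when there is a basis `(e₁, e₂)` of `F²` with `v = [𝒪 e₁ ⊕ 𝒪 e₂]` and
`w = [𝒪 e₁ ⊕ 𝔭 e₂]`, where `𝔭 = ϖ 𝒪`. -/
def IsEdge (v w : Vertex F) : Prop :=
  ∃ (L M : FullLattice F) (e : Module.Basis (Fin 2) F (Fin 2 → F)) (ϖ : 𝒪[F]), Irreducible ϖ ∧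
    L.1 = Submodule.span 𝒪[F] {e 0, e 1} ∧ M.1 = Submodule.span 𝒪[F] {e 0, ϖ • e 1} ∧
    L.toVertex = v ∧ M.toVertex = w

theorem IsEdge.symm {v w : Vertex F} (h : IsEdge v w) : IsEdge w v := by
  obtain ⟨L, M, e, ϖ, hϖ, hL, hM, rfl, rfl⟩ := h
  have h0 : (ϖ : F) ≠ 0 := fun h => hϖ.ne_zero (Subtype.ext h)
  let c : Fˣ := Units.mk0 ϖ h0
  have he : ∀ x : Fin 2 → F, c • x = ϖ • x := fun x => rfl
  refine ⟨M, c • L, (e.unitsSMul ![1, c]).reindex (Equiv.swap 0 1), ϖ, hϖ, ?_, ?_, rfl, ?_⟩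
  · rw [hM, Set.pair_comm]
    simp [Module.Basis.unitsSMul_apply, he]
  · ext x
    rw [mem_homothety, hL]
    simp only [Module.Basis.reindex_apply, Equiv.symm_swap, Equiv.swap_apply_left,
      Equiv.swap_apply_right, Module.Basis.unitsSMul_apply, Matrix.cons_val_zero,
      Matrix.cons_val_one, one_smul, he, Submodule.mem_span_pair]
    constructor
    · rintro ⟨_, ⟨a, b, rfl⟩, rfl⟩
      exact ⟨b, a, by module⟩
    · rintro ⟨b, a, rfl⟩
      exact ⟨_, ⟨a, b, rfl⟩, by module⟩
  · rw [FullLattice.toVertex_eq_iff]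
    exact ⟨c, rfl⟩

theorem not_isEdge_self (v : Vertex F) : ¬ IsEdge v v := by
  rintro ⟨L, M, e, ϖ, hϖ, hL, hM, hv, hw⟩
  obtain ⟨c, rfl⟩ := FullLattice.toVertex_eq_iff.1 (hw.trans hv.symm)
  have hli := e.linearIndependent
  have key : ∀ a b a' b' : F, a • e 0 + b • e 1 = a' • e 0 + b' • e 1 → a = a' ∧ b = b' := by
    intro a b a' b' h
    have h1 := congrArg (fun x => e.repr x 0) h
    have h2 := congrArg (fun x => e.repr x 1) h
    simp at h1 h2
    exact ⟨h1, h2⟩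
  have h0 : e 0 ∈ (c • L).1 := hM ▸ Submodule.subset_span (by simp)
  obtain ⟨y, hy, hy0⟩ := mem_homothety.1 h0
  rw [hL] at hy
  obtain ⟨a, b, rfl⟩ := Submodule.mem_span_pair.1 hy
  have hca : (c : F) * a = 1 := by
    refine (key (c * a) (c * b) 1 0 ?_).1
    rw [one_smul, zero_smul, add_zero, mul_smul, mul_smul, ← smul_add]
    exact hy0
  have h1 : c • e 1 ∈ (c • L).1 :=
    mem_homothety.2 ⟨e 1, hL ▸ Submodule.subset_span (by simp), rfl⟩
  rw [hM] at h1
  obtain ⟨a', b', h⟩ := Submodule.mem_span_pair.1 h1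
  have hcb : (b' : F) * ϖ = c := by
    refine (key a' (b' * ϖ) 0 c ?_).2
    rw [zero_smul, zero_add, mul_smul]
    exact h
  refine hϖ.not_isUnit (IsUnit.of_mul_eq_one (b' * a) (Subtype.ext ?_))
  change (ϖ : F) * (b' * a) = 1
  rw [← hca, ← hcb]
  ring

variable (F) in
/-- The Bruhat-Tits tree of `PGL(2, F)`. -/
def tree : SimpleGraph (Vertex F) where
  Adj := IsEdge
  symm := ⟨fun _ _ h => h.symm⟩
  loopless := ⟨not_isEdge_self⟩

theorem mapLattice_span_pair (g : GL (Fin 2) F) (x y : Fin 2 → F) :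
    mapLattice g (Submodule.span 𝒪[F] {x, y}) =
      Submodule.span 𝒪[F] {(g : Matrix (Fin 2) (Fin 2) F).mulVec x,
        (g : Matrix (Fin 2) (Fin 2) F).mulVec y} := by
  rw [mapLattice, Submodule.map_span, Set.image_pair]
  rfl

theorem IsEdge.smul {v w : Vertex F} (h : IsEdge v w) (g : PGL(2, F)) :
    IsEdge (g • v) (g • w) := by
  obtain ⟨g, rfl⟩ := Matrix.ProjGenLinGroup.mk_surjective g
  obtain ⟨L, M, e, ϖ, hϖ, hL, hM, rfl, rfl⟩ := h
  refine ⟨g • L, g • M, e.map (Matrix.GeneralLinearGroup.toLin g).toLinearEquiv, ϖ, hϖ,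
    ?_, ?_, rfl, rfl⟩
  · change mapLattice g L.1 = _
    rw [hL, mapLattice_span_pair]
    rfl
  · change mapLattice g M.1 = _
    rw [hM, mapLattice_span_pair]
    congr 2
    exact congrArg _ (Matrix.mulVec_smul _ ϖ (e 1))

/-- The action of `PGL(2, F)` on the oriented edges of the tree. -/
instance : MulAction PGL(2, F) (tree F).Dart where
  smul g a := ⟨(g • a.fst, g • a.snd), IsEdge.smul a.adj g⟩
  one_smul a := SimpleGraph.Dart.ext _ _ (Prod.ext (one_smul _ a.fst) (one_smul _ a.snd))
  mul_smul g h a :=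
    SimpleGraph.Dart.ext _ _ (Prod.ext (mul_smul g h a.fst) (mul_smul g h a.snd))

theorem smul_fst (g : PGL(2, F)) (a : (tree F).Dart) : (g • a).fst = g • a.fst := rfl

theorem smul_snd (g : PGL(2, F)) (a : (tree F).Dart) : (g • a).snd = g • a.snd := rfl

end Tree

/-! ### The directed graph `X̃₀` and its cohomology with compact support

The directed graph `X̃₀` has the vertices of the tree as vertices and the oriented edges (darts) of
the tree as edges, with tail `a.fst` and head `a.snd`. So an edge `{s, t}` of the tree yields two
distinct edges of `X̃₀`. -/

section Cohomology

variable {F : Type*} [Field F] [ValuativeRel F] [TopologicalSpace F]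
  [IsNonarchimedeanLocalField F]

/-- Every vertex of the tree has finitely many neighbours. -/
theorem finite_neighbors (v : Vertex F) : {w | IsEdge v w}.Finite := by
  obtain ⟨N, rfl⟩ := v.exists_rep
  let 𝔪 : Ideal 𝒪[F] := IsLocalRing.maximalIdeal 𝒪[F]
  let S : Set (Submodule 𝒪[F] (Fin 2 → F)) := {M | 𝔪 • N.1 ≤ M ∧ M ≤ N.1}
  have hS : S.Finite := by
    have : Module.Finite 𝒪[F] N.1 := Module.Finite.iff_fg.2 N.2.fg
    have : Finite (𝒪[F] ⧸ 𝔪) := inferInstanceAs (Finite 𝓀[F])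
    have : Finite (N.1 ⧸ (𝔪 • ⊤ : Submodule 𝒪[F] N.1)) :=
      Module.finite_of_finite (𝒪[F] ⧸ 𝔪)
    have : Finite (Submodule 𝒪[F] (N.1 ⧸ (𝔪 • ⊤ : Submodule 𝒪[F] N.1))) :=
      Finite.of_injective (β := Set (N.1 ⧸ (𝔪 • ⊤ : Submodule 𝒪[F] N.1))) SetLike.coe
        SetLike.coe_injective
    refine Set.Finite.subset (Set.finite_range (fun P : Submodule 𝒪[F]
      (N.1 ⧸ (𝔪 • ⊤ : Submodule 𝒪[F] N.1)) => (P.comap (Submodule.mkQ _)).map N.1.subtype)) ?_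
    rintro M ⟨h1, h2⟩
    refine ⟨(M.comap N.1.subtype).map (Submodule.mkQ _), ?_⟩
    change ((((M.comap N.1.subtype).map (Submodule.mkQ _)).comap _).map _) = M
    rw [Submodule.comap_map_mkQ, sup_eq_right.2, Submodule.map_comap_subtype, inf_eq_right.2 h2]
    rw [← Submodule.map_le_iff_le_comap, Submodule.map_smul'', Submodule.map_top,
      Submodule.range_subtype]
    exact h1
  have hT : {M : FullLattice F | M.1 ∈ S}.Finite :=
    hS.preimage (Subtype.val_injective.injOn)
  refine (hT.image FullLattice.toVertex).subset ?_
  rintro _ ⟨L, M, e, ϖ, hϖ, hL, hM, hv, rfl⟩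
  obtain ⟨c, rfl⟩ := FullLattice.toVertex_eq_iff.1 hv.symm
  refine ⟨c • M, ⟨?_, ?_⟩, FullLattice.toVertex_eq_iff.2 ⟨c, rfl⟩⟩
  · rw [Submodule.smul_le]
    intro r hr x hx
    have hr' : r ∈ Ideal.span {ϖ} := hϖ.maximalIdeal_eq ▸ hr
    obtain ⟨s, rfl⟩ := Ideal.mem_span_singleton'.1 hr'
    obtain ⟨y, hy, rfl⟩ := mem_homothety.1 hx
    rw [hL] at hy
    obtain ⟨a, b, rfl⟩ := Submodule.mem_span_pair.1 hy
    refine mem_homothety.2 ⟨(s * ϖ) • (a • e 0 + b • e 1), ?_, (smul_comm _ _ _).symm⟩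
    rw [hM]
    exact Submodule.mem_span_pair.2 ⟨s * ϖ * a, s * b, by module⟩
  · intro x hx
    obtain ⟨y, hy, rfl⟩ := mem_homothety.1 hx
    rw [hM] at hy
    obtain ⟨a, b, rfl⟩ := Submodule.mem_span_pair.1 hy
    refine mem_homothety.2 ⟨_, ?_, rfl⟩
    rw [hL]
    exact Submodule.mem_span_pair.2 ⟨a, b * ϖ, by module⟩

theorem finite_support_coboundary (f : Vertex F →₀ ℂ) :
    (Function.support fun a : (tree F).Dart => f a.snd - f a.fst).Finite := by
  have h : (⋃ v ∈ f.support, {p : Vertex F × Vertex F |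
      (p.1 = v ∧ IsEdge v p.2) ∨ (p.2 = v ∧ IsEdge v p.1)}).Finite := by
    refine Set.Finite.biUnion f.support.finite_toSet fun v _ => ?_
    refine (((finite_neighbors v).image fun w => (v, w)).union
      ((finite_neighbors v).image fun w => (w, v))).subset ?_
    rintro ⟨x, y⟩ (⟨rfl, h⟩ | ⟨rfl, h⟩)
    · exact Or.inl ⟨y, h, rfl⟩
    · exact Or.inr ⟨x, h, rfl⟩
  refine (h.preimage (SimpleGraph.Dart.toProd_injective.injOn)).subset ?_
  intro a ha
  simp only [Set.mem_preimage, Set.mem_iUnion]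
  by_cases h1 : f a.fst = 0
  · have h2 : f a.snd ≠ 0 := by
      intro h2
      exact ha (by simp [h1, h2])
    exact ⟨a.snd, Finsupp.mem_support_iff.2 h2, Or.inr ⟨rfl, a.adj.symm⟩⟩
  · exact ⟨a.fst, Finsupp.mem_support_iff.2 h1, Or.inl ⟨rfl, a.adj⟩⟩

variable (F) in
/-- The coboundary `d : C_c^0(X̃₀) → C_c^1(X̃₀)`, `(d f)(a) = f (head a) - f (tail a)`, where the
cochains are the finitely supported complex functions on the vertices, resp. the edges. -/
def coboundary : (Vertex F →₀ ℂ) →ₗ[ℂ] ((tree F).Dart →₀ ℂ) where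
  toFun f := Finsupp.ofSupportFinite (fun a => f a.snd - f a.fst) (finite_support_coboundary f)
  map_add' f f' := by
    ext a
    simp only [Finsupp.ofSupportFinite_coe, Finsupp.add_apply]
    ring
  map_smul' c f := by
    ext a
    simp only [Finsupp.ofSupportFinite_coe, Finsupp.smul_apply, RingHom.id_apply, smul_sub]

theorem coboundary_apply (f : Vertex F →₀ ℂ) (a : (tree F).Dart) :
    coboundary F f a = f a.snd - f a.fst := rfl

theorem coboundary_permRep (g : PGL(2, F)) (f : Vertex F →₀ ℂ) :
    coboundary F (permRep PGL(2, F) (Vertex F) g f) =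
      permRep PGL(2, F) (tree F).Dart g (coboundary F f) := by
  ext a
  simp only [coboundary_apply, permRep_apply, smul_fst, smul_snd]

variable (F) in
/-- The representation of `PGL(2, F)` on
`H_c^1(X̃₀) = C_c^1(X̃₀) / d C_c^0(X̃₀)`. -/
def cohomology :
    Representation ℂ PGL(2, F) (((tree F).Dart →₀ ℂ) ⧸ LinearMap.range (coboundary F)) :=
  (permRep PGL(2, F) (tree F).Dart).quotient (LinearMap.range (coboundary F)) (by
    rintro g _ ⟨f, rfl⟩
    exact ⟨_, coboundary_permRep g f⟩)

end Cohomology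

end TreeCohomology

end

/-! Since 2 is invertible in `ℂ`, a cochain on oriented edges is the sum of an antisymmetric and a
symmetric part under reversal, and coboundaries are antisymmetric. The cohomology is therefore the
sum of the antisymmetric cochains modulo coboundaries and of the symmetric cochains.

Symmetric cochains are finitely supported functions on unoriented edges. The group permutes these
edges transitively, and the stabilizer of the standard edge is the normalizer of the Iwahori
subgroup, because the Iwahori subgroup fixes no vertices besides the two ends of that edge
(`eq_ray_of_iwahori_fixed`, `mem_iwahoriNormalizer_iff`). This gives the compactly induced summand.

An antisymmetric cochain is integrated along paths to a potential `h` on the vertices, unique up to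
a constant (`primitive_snd_sub_fst`, `exists_eq_add_of_coboundary_eq`). Off finitely many edges `h`
does not change, so it has a limit at each end of the tree. The Borel subgroup fixes the end of the
standard ray, and `h` becomes a smooth function on `B \ G`. Every such function arises
(`exists_boundaryValue_eq`), and the limit function is constant exactly when `h` is finitely
supported up to a constant (`finite_ne_of_boundaryValue_eq`), that is, when the cochain is a
coboundary. The constant of integration is the reason for dividing by the constants, and the result
is the Steinberg representation.

The geometry of the tree is handled in coordinates: each vertex is `k • ray n` with `k` in `GL(2,
𝒪)`, and `intGL_smul_ray_iff` decides when two such expressions agree. -/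

noncomputable section

namespace TreeCohomology

/-! ### The standard ray of vertices -/

section Ray

variable (F : Type*) [Field F] [ValuativeRel F]

/-- The standard lattice `𝒪²`. -/
def stdLattice : FullLattice F :=
  ⟨Submodule.span 𝒪[F] {Pi.single 0 1, Pi.single 1 1}, by
    refine ⟨Submodule.fg_span (Set.toFinite _), ?_⟩
    rw [Submodule.span_span_of_tower, eq_top_iff]
    intro x _
    exact Submodule.mem_span_pair.2 ⟨x 0, x 1, by ext i; fin_cases i <;> simp⟩⟩

variable {F}

theorem mem_stdLattice {x : Fin 2 → F} : x ∈ (stdLattice F).1 ↔ ∀ i, x i ∈ 𝒪[F] := by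
  rw [stdLattice, Submodule.mem_span_pair]
  constructor
  · rintro ⟨a, b, rfl⟩ i
    fin_cases i
    · simp [Subring.smul_def]
    · simp [Subring.smul_def]
  · intro h
    exact ⟨⟨x 0, h 0⟩, ⟨x 1, h 1⟩, by ext i; fin_cases i <;> simp [Subring.smul_def]⟩

variable (F) in
/-- The base vertex `[𝒪²]`. -/
def baseVertex : Vertex F := (stdLattice F).toVertex

variable (F) in
/-- The natural map `GL(2, 𝒪) → PGL(2, F)`. -/
def intGL : GL (Fin 2) 𝒪[F] →* PGL(2, F) :=
  Matrix.ProjGenLinGroup.mk.comp (Matrix.GeneralLinearGroup.map (algebraMap 𝒪[F] F))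

omit [ValuativeRel F] in
theorem mk_eq_mk_of_smul {g h : GL (Fin 2) F} {c : F} (hc : c ≠ 0)
    (H : (g : Matrix (Fin 2) (Fin 2) F) = c • (h : Matrix (Fin 2) (Fin 2) F)) :
    (Matrix.ProjGenLinGroup.mk g : PGL(2, F)) = Matrix.ProjGenLinGroup.mk h := by
  symm
  rw [Matrix.ProjGenLinGroup.mk_eq_mk_iff]
  refine ⟨Units.mk0 c hc, Units.ext ?_⟩
  rw [Units.val_mul, H]
  ext i j
  simp [Matrix.GeneralLinearGroup.scalar, mul_comm]

omit [ValuativeRel F] in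
theorem exists_smul_of_mk_eq_mk {g h : GL (Fin 2) F}
    (H : (Matrix.ProjGenLinGroup.mk g : PGL(2, F)) = Matrix.ProjGenLinGroup.mk h) :
    ∃ c : F, c ≠ 0 ∧ (g : Matrix (Fin 2) (Fin 2) F) = c • (h : Matrix (Fin 2) (Fin 2) F) := by
  obtain ⟨u, hu⟩ := Matrix.ProjGenLinGroup.mk_eq_mk_iff.1 H.symm
  refine ⟨u, u.ne_zero, ?_⟩
  rw [← hu, Units.val_mul]
  ext i j
  simp [Matrix.GeneralLinearGroup.scalar, mul_comm]

/-- A matrix with integral entries whose inverse has integral entries lifts to `GL(2, 𝒪)`. -/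
theorem exists_lift_of_integral {g : GL (Fin 2) F}
    (h : ∀ i j, (g : Matrix (Fin 2) (Fin 2) F) i j ∈ 𝒪[F])
    (h' : ∀ i j, ((g⁻¹ : GL (Fin 2) F) : Matrix (Fin 2) (Fin 2) F) i j ∈ 𝒪[F]) :
    ∃ k : GL (Fin 2) 𝒪[F], Matrix.GeneralLinearGroup.map (algebraMap 𝒪[F] F) k = g := by
  have hinj : Function.Injective (fun A : Matrix (Fin 2) (Fin 2) 𝒪[F] =>
      A.map (algebraMap 𝒪[F] F)) := Matrix.map_injective Subtype.val_injective
  let A : Matrix (Fin 2) (Fin 2) 𝒪[F] := fun i j => ⟨_, h i j⟩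
  let B : Matrix (Fin 2) (Fin 2) 𝒪[F] := fun i j => ⟨_, h' i j⟩
  have hA : A.map (algebraMap 𝒪[F] F) = (g : Matrix (Fin 2) (Fin 2) F) := rfl
  have hB : B.map (algebraMap 𝒪[F] F) = ((g⁻¹ : GL (Fin 2) F) : Matrix (Fin 2) (Fin 2) F) := rfl
  refine ⟨⟨A, B, hinj ?_, hinj ?_⟩, Units.ext rfl⟩
  · simp only [Matrix.map_mul, hA, hB, ← Units.val_mul]
    ext i j
    simp [Matrix.one_apply]
  · simp only [Matrix.map_mul, hA, hB, ← Units.val_mul]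
    ext i j
    simp [Matrix.one_apply]

theorem integral_of_smul_stdLattice_le {g : GL (Fin 2) F}
    (h : (g • stdLattice F).1 ≤ (stdLattice F).1) (i j : Fin 2) :
    (g : Matrix (Fin 2) (Fin 2) F) i j ∈ 𝒪[F] := by
  have := mem_stdLattice.1 (h (mem_smul_lattice.2 ⟨Pi.single j 1,
    mem_stdLattice.2 fun l => by
      by_cases hl : l = j
      · subst hl; simp
      · simp [hl], rfl⟩)) i
  simpa using this

theorem smul_stdLattice_le_of_integral {g : GL (Fin 2) F}
    (h : ∀ i j, (g : Matrix (Fin 2) (Fin 2) F) i j ∈ 𝒪[F]) :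
    (g • stdLattice F).1 ≤ (stdLattice F).1 := by
  rintro _ ⟨y, hy, rfl⟩
  refine mem_stdLattice.2 fun i => ?_
  simp only [SetLike.mem_coe, mem_stdLattice] at hy
  change (g : Matrix (Fin 2) (Fin 2) F).mulVec y i ∈ _
  rw [Matrix.mulVec, dotProduct]
  exact sum_mem fun j _ => mul_mem (h i j) (hy j)

theorem map_smul_stdLattice (k : GL (Fin 2) 𝒪[F]) :
    (Matrix.GeneralLinearGroup.map (algebraMap 𝒪[F] F) k) • stdLattice F = stdLattice F := by
  have key : ∀ k : GL (Fin 2) 𝒪[F],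
      ((Matrix.GeneralLinearGroup.map (algebraMap 𝒪[F] F) k) • stdLattice F).1 ≤
        (stdLattice F).1 := fun k => smul_stdLattice_le_of_integral fun i j => by
    exact (k i j).2
  refine Subtype.ext (le_antisymm (key k) fun x hx => ?_)
  refine mem_smul_lattice.2 ⟨_, key k⁻¹ ⟨x, hx, rfl⟩, ?_⟩
  rw [map_inv]
  change Matrix.mulVec _ (Matrix.mulVec _ x) = x
  rw [Matrix.mulVec_mulVec, ← Units.val_mul, mul_inv_cancel, Units.val_one, Matrix.one_mulVec]

theorem intGL_smul_baseVertex (k : GL (Fin 2) 𝒪[F]) : intGL F k • baseVertex F = baseVertex F :=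
  (mk_smul_toVertex _ _).trans (congrArg _ (map_smul_stdLattice k))

/-- Dividing a representative by the homothety factor makes it preserve `𝒪²` exactly. It and its
inverse then have integral entries, so it lifts to `GL(2, 𝒪)`. -/
theorem smul_baseVertex_eq_iff {g : PGL(2, F)} :
    g • baseVertex F = baseVertex F ↔ ∃ k, intGL F k = g := by
  constructor
  · obtain ⟨g, rfl⟩ := Matrix.ProjGenLinGroup.mk_surjective g
    intro h
    obtain ⟨c, hc⟩ := FullLattice.toVertex_eq_iff.1 ((mk_smul_toVertex _ _).symm.trans h)
    let g' : GL (Fin 2) F := Matrix.GeneralLinearGroup.scalar (Fin 2) c⁻¹ * g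
    have hs : ∀ (c : Fˣ) (x : Fin 2 → F), (Matrix.GeneralLinearGroup.scalar (Fin 2) c :
        Matrix (Fin 2) (Fin 2) F).mulVec x = c • x := by
      intro c x
      ext i
      simp [Units.smul_def]
    have hg' : g' • stdLattice F = stdLattice F := by
      rw [mul_smul, ← hc]
      apply Subtype.ext
      ext x
      simp only [mem_smul_lattice, mem_homothety, hs]
      constructor
      · rintro ⟨_, ⟨y, hy, rfl⟩, rfl⟩
        simpa using hy
      · intro hx
        exact ⟨_, ⟨x, hx, rfl⟩, by simp⟩
    have hg'' : g'⁻¹ • stdLattice F = stdLattice F := by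
      rw [inv_smul_eq_iff, hg']
    obtain ⟨k, hk⟩ := exists_lift_of_integral
      (integral_of_smul_stdLattice_le (congrArg Subtype.val hg').le)
      (integral_of_smul_stdLattice_le (congrArg Subtype.val hg'').le)
    refine ⟨k, ?_⟩
    change Matrix.ProjGenLinGroup.mk _ = _
    rw [hk, map_mul, Matrix.ProjGenLinGroup.mk_scalar, one_mul]
  · rintro ⟨k, rfl⟩
    exact intGL_smul_baseVertex k

end Ray

/-! ### The action of `GL(2, 𝒪)` on the standard ray. -/

section Decompositions

theorem isUnit_det_GL {R : Type*} [CommRing R] (k : GL (Fin 2) R) :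
    IsUnit (k 0 0 * k 1 1 - k 0 1 * k 1 0) := by
  have := (Matrix.isUnit_iff_isUnit_det _).1 k.isUnit
  rwa [Matrix.det_fin_two] at this

/-- The lower unitriangular matrix with entry `x`. -/
def lowerGL {R : Type*} [CommRing R] (x : R) : GL (Fin 2) R :=
  Matrix.GeneralLinearGroup.mk'' !![1, 0; x, 1] (by simp [Matrix.det_fin_two])

/-- The permutation matrix of the transposition. -/
def swapGL (R : Type*) [CommRing R] : GL (Fin 2) R :=
  Matrix.GeneralLinearGroup.mk'' !![0, 1; 1, 0] (by simp [Matrix.det_fin_two])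

theorem swapGL_mul_self (R : Type*) [CommRing R] : swapGL R * swapGL R = 1 := by
  apply Units.ext
  ext i j
  fin_cases i <;> fin_cases j <;> simp [swapGL]

theorem inv_swapGL (R : Type*) [CommRing R] : (swapGL R)⁻¹ = swapGL R :=
  inv_eq_of_mul_eq_one_left (swapGL_mul_self R)

theorem inv_lowerGL {R : Type*} [CommRing R] (x : R) : (lowerGL x)⁻¹ = lowerGL (-x) := by
  refine inv_eq_of_mul_eq_one_left (Units.ext ?_)
  ext i j
  fin_cases i <;> fin_cases j <;> simp [lowerGL]

variable (F : Type*) [Field F] [ValuativeRel F]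

variable {F} in
theorem algebraMap_integer (x : 𝒪[F]) : algebraMap 𝒪[F] F x = x := rfl

theorem mem_integer_or_inv_mem (x : F) : x ∈ 𝒪[F] ∨ x⁻¹ ∈ 𝒪[F] := by
  simp only [Valuation.mem_integer_iff, map_inv₀]
  rcases le_total (ValuativeRel.valuation F x) 1 with h | h
  · exact Or.inl h
  · exact Or.inr (inv_le_one_of_one_le₀ h)

variable [TopologicalSpace F] [IsNonarchimedeanLocalField F]

/-- A uniformizer of `𝒪`. -/
def unif : 𝒪[F] := (IsDiscreteValuationRing.exists_irreducible 𝒪[F]).choose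

theorem unif_irreducible : Irreducible (unif F) :=
  (IsDiscreteValuationRing.exists_irreducible 𝒪[F]).choose_spec

theorem unif_ne_zero : (unif F : F) ≠ 0 := fun h => (unif_irreducible F).ne_zero (Subtype.ext h)

variable {F} in
theorem unif_pow_dvd_unif_pow {m n : ℕ} : unif F ^ m ∣ unif F ^ n ↔ m ≤ n :=
  pow_dvd_pow_iff (unif_irreducible F).ne_zero (unif_irreducible F).not_isUnit

/-- The matrix `diag(1, ϖⁿ)`. -/
def shiftGL (n : ℕ) : GL (Fin 2) F :=
  Matrix.GeneralLinearGroup.mkOfDetNeZero !![1, 0; 0, (unif F : F) ^ n]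
    (by simpa [Matrix.det_fin_two] using fun h => absurd (congrArg Subtype.val h) (unif_ne_zero F))

theorem val_shiftGL (n : ℕ) : (shiftGL F n : Matrix (Fin 2) (Fin 2) F) =
    !![1, 0; 0, (unif F : F) ^ n] := rfl

/-- The class of `diag(1, ϖⁿ)` in `PGL(2, F)`. -/
def shift (n : ℕ) : PGL(2, F) := Matrix.ProjGenLinGroup.mk (shiftGL F n)

/-- The vertices `[𝒪 e₁ ⊕ 𝔭ⁿ e₂]`. -/
def ray (n : ℕ) : Vertex F := shift F n • baseVertex F

theorem shift_mul_shift (m n : ℕ) : shift F m * shift F n = shift F (m + n) := by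
  rw [shift, shift, ← map_mul]
  refine congrArg _ (Units.ext ?_)
  rw [Units.val_mul]
  simp only [val_shiftGL]
  ext i j
  fin_cases i <;> fin_cases j <;> simp [pow_add]

theorem shift_zero : shift F 0 = 1 := by
  have := shift_mul_shift F 0 0
  simpa using this

theorem ray_zero : ray F 0 = baseVertex F := by
  rw [ray, shift_zero, one_smul]

theorem shift_smul_ray (m n : ℕ) : shift F m • ray F n = ray F (m + n) := by
  rw [ray, ray, ← mul_smul, shift_mul_shift]

variable {F}

/-- Conjugating `k` by `diag(1, ϖⁿ)` divides the lower left entry by `ϖⁿ`, and the result must again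
be integral. This is the coordinate description of vertices on which all later arguments about the
tree rest. -/
theorem intGL_smul_ray_iff {k : GL (Fin 2) 𝒪[F]} {m n : ℕ} :
    intGL F k • ray F n = ray F m ↔ n = m ∧ unif F ^ n ∣ k 1 0 := by
  constructor
  · intro h
    have h1 : ((shift F m)⁻¹ * (intGL F k * shift F n)) • baseVertex F = baseVertex F := by
      rw [mul_smul, inv_smul_eq_iff, mul_smul]
      exact h
    obtain ⟨k', hk'⟩ := smul_baseVertex_eq_iff.1 h1
    rw [eq_inv_mul_iff_mul_eq, intGL, shift, shift] at hk'
    simp only [MonoidHom.comp_apply, ← map_mul] at hk'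
    obtain ⟨c, hc, H⟩ := exists_smul_of_mk_eq_mk hk'.symm
    rw [Units.val_mul, Units.val_mul] at H
    simp only [val_shiftGL] at H
    have e00 := congrFun (congrFun H 0) 0
    have e01 := congrFun (congrFun H 0) 1
    have e10 := congrFun (congrFun H 1) 0
    have e11 := congrFun (congrFun H 1) 1
    clear H hk' h1 h
    have hd := isUnit_det_GL k
    have hd' := isUnit_det_GL k'
    simp only [Matrix.GeneralLinearGroup.map_apply, Matrix.mul_apply, Fin.sum_univ_two,
      Matrix.smul_apply, smul_eq_mul] at e00 e01 e10 e11
    simp at e00 e01 e10 e11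
    change (k 0 0 : F) = c * (k' 0 0 : F) at e00
    change (k 0 1 : F) * unif F ^ n = c * (k' 0 1 : F) at e01
    change (k 1 0 : F) = c * (unif F ^ m * (k' 1 0 : F)) at e10
    change (k 1 1 : F) * unif F ^ n = c * (unif F ^ m * (k' 1 1 : F)) at e11
    -- The scalar is a unit: if `c` is integral it divides the first column of `k`, hence its
    -- determinant; if `c⁻¹` is integral it divides the first row of `k'`, hence that determinant.
    obtain ⟨c, rfl⟩ : ∃ u : 𝒪[F]ˣ, (u : 𝒪[F]) = c := by
      rcases mem_integer_or_inv_mem F c with hi | hi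
      · have : IsUnit (⟨c, hi⟩ : 𝒪[F]) := by
          refine isUnit_of_dvd_unit ?_ hd
          refine dvd_sub (dvd_mul_of_dvd_left ⟨k' 0 0, Subtype.ext e00⟩ _)
            (dvd_mul_of_dvd_right ⟨unif F ^ m * k' 1 0, Subtype.ext ?_⟩ _)
          simpa using e10
        exact ⟨this.unit, rfl⟩
      · have : IsUnit (⟨c⁻¹, hi⟩ : 𝒪[F]) := by
          refine isUnit_of_dvd_unit ?_ hd'
          refine dvd_sub (dvd_mul_of_dvd_left ⟨k 0 0, Subtype.ext ?_⟩ _)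
            (dvd_mul_of_dvd_left ⟨k 0 1 * unif F ^ n, Subtype.ext ?_⟩ _)
          · change (k' 0 0 : F) = c⁻¹ * k 0 0
            rw [e00, inv_mul_cancel_left₀ hc]
          · change (k' 0 1 : F) = c⁻¹ * (k 0 1 * (unif F : F) ^ n)
            rw [e01, inv_mul_cancel_left₀ hc]
        refine ⟨this.unit⁻¹, ?_⟩
        have h2 : ((↑(this.unit⁻¹) : 𝒪[F]) : F) * c⁻¹ = 1 :=
          congrArg Subtype.val this.val_inv_mul
        exact (mul_inv_eq_one₀ hc).1 h2
    have e10' : k 1 0 = c * (unif F ^ m * k' 1 0) := Subtype.ext (by simpa using e10)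
    -- Comparing determinants, which are units up to the powers of `ϖ`, forces `n = m`.
    have hdet : (k 0 0 * k 1 1 - k 0 1 * k 1 0) * unif F ^ n =
        (c * c * (k' 0 0 * k' 1 1 - k' 0 1 * k' 1 0)) * unif F ^ m := by
      apply Subtype.ext
      push_cast
      linear_combination (k 1 1 : F) * unif F ^ n * e00 + (c : F) * k' 0 0 * e11
        - (k 1 0 : F) * e01 - (c : F) * k' 0 1 * e10
    have hu : IsUnit ((c : 𝒪[F]) * c * (k' 0 0 * k' 1 1 - k' 0 1 * k' 1 0)) :=
      (c.isUnit.mul c.isUnit).mul hd'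
    have hnm : n = m := by
      apply le_antisymm
      · rw [← unif_pow_dvd_unif_pow (F := F), ← hu.dvd_mul_left, ← hdet]
        exact dvd_mul_left _ _
      · rw [← unif_pow_dvd_unif_pow (F := F), ← hd.dvd_mul_left, hdet]
        exact dvd_mul_left _ _
    refine ⟨hnm, ?_⟩
    rw [hnm, e10']
    exact dvd_mul_of_dvd_right (dvd_mul_right _ _) _
  · rintro ⟨rfl, r, hr⟩
    have hd := isUnit_det_GL k
    -- The conjugate of `k` by `diag(1, ϖⁿ)`, integral by the divisibility assumption.
    let k' : GL (Fin 2) 𝒪[F] := Matrix.GeneralLinearGroup.mk''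
      !![k 0 0, k 0 1 * unif F ^ n; r, k 1 1] (by
        rw [Matrix.det_fin_two]
        convert! hd using 1
        rw [hr]
        simp
        ring)
    have hk : intGL F k * shift F n = shift F n * intGL F k' := by
      simp only [intGL, shift, MonoidHom.comp_apply, ← map_mul]
      refine congrArg _ (Units.ext ?_)
      rw [Units.val_mul, Units.val_mul]
      ext i j
      have hr' : (k 1 0 : F) = unif F ^ n * r := by rw [hr]; simp
      fin_cases i <;> fin_cases j <;>
        simp [val_shiftGL, Matrix.mul_apply, k', mul_comm]
      · exact mul_comm (unif F ^ n : F) (k 0 1 : F)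
      · exact hr'
    rw [ray, ← mul_smul, hk, mul_smul, intGL_smul_baseVertex]

end Decompositions

/-! ### Transitivity on vertices and edges; Iwasawa and Cartan decompositions. -/

section Orbits

variable {F : Type*} [Field F]

/-- The matrix whose columns form a given basis. -/
def basisGL (e : Module.Basis (Fin 2) F (Fin 2 → F)) : GL (Fin 2) F :=
  Matrix.GeneralLinearGroup.mk'' ((Pi.basisFun F (Fin 2)).toMatrix e) (by
    rw [← Module.Basis.det_apply]
    exact (Pi.basisFun F (Fin 2)).isUnit_det e)

theorem basisGL_mulVec (e : Module.Basis (Fin 2) F (Fin 2 → F)) (x : Fin 2 → F) :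
    (basisGL e : Matrix (Fin 2) (Fin 2) F).mulVec x = x 0 • e 0 + x 1 • e 1 := by
  ext i
  simp [basisGL, Matrix.mulVec, dotProduct, Module.Basis.toMatrix_apply, mul_comm]

variable [ValuativeRel F]

theorem smul_stdLattice (g : GL (Fin 2) F) : (g • stdLattice F).1 =
    Submodule.span 𝒪[F] {(g : Matrix (Fin 2) (Fin 2) F).mulVec (Pi.single 0 1),
      (g : Matrix (Fin 2) (Fin 2) F).mulVec (Pi.single 1 1)} :=
  mapLattice_span_pair g _ _

theorem basisGL_smul_stdLattice (e : Module.Basis (Fin 2) F (Fin 2 → F)) :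
    (basisGL e • stdLattice F).1 = Submodule.span 𝒪[F] {e 0, e 1} := by
  rw [smul_stdLattice, basisGL_mulVec, basisGL_mulVec]
  simp

variable [TopologicalSpace F] [IsNonarchimedeanLocalField F]

/-- A lattice is free of rank 2 over `𝒪`, and the matrix of an `𝒪`-basis carries `𝒪²` to it. -/
theorem exists_smul_baseVertex (v : Vertex F) : ∃ g : PGL(2, F), g • baseVertex F = v := by
  obtain ⟨L, rfl⟩ := v.exists_rep
  have := L.2
  have hfree : Module.Free 𝒪[F] L.1 := Submodule.IsLattice.free F L.1
  have hrank : Module.finrank 𝒪[F] L.1 = 2 := by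
    simpa using Submodule.IsLattice.finrank_of_pi F L.1
  let b := Module.finBasisOfFinrankEq 𝒪[F] L.1 hrank
  refine ⟨Matrix.ProjGenLinGroup.mk (basisGL (b.extendOfIsLattice F)), ?_⟩
  refine (mk_smul_toVertex _ _).trans (congrArg _ (Subtype.ext ?_))
  rw [basisGL_smul_stdLattice, Module.Basis.extendOfIsLattice_apply,
    Module.Basis.extendOfIsLattice_apply]
  have h := congrArg (Submodule.map L.1.subtype) b.span_eq
  rw [Submodule.map_span, Submodule.map_top, Submodule.range_subtype] at h
  refine (congrArg _ ?_).trans h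
  ext x
  simp [eq_comm]

theorem ray_eq_toVertex (n : ℕ) : ray F n = (shiftGL F n • stdLattice F).toVertex :=
  mk_smul_toVertex _ _

theorem isEdge_ray (n : ℕ) : IsEdge (ray F n) (ray F (n + 1)) := by
  rw [← shift_smul_ray F n 1, ← add_zero n, ← shift_smul_ray F n 0, add_zero]
  refine IsEdge.smul ?_ _
  refine ⟨stdLattice F, shiftGL F 1 • stdLattice F, Pi.basisFun F (Fin 2), unif F,
    unif_irreducible F, ?_, ?_, ?_, ?_⟩
  · simp [stdLattice]
  · rw [smul_stdLattice]
    congr 2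
    · ext i; fin_cases i <;> simp [val_shiftGL]
    · congr 1
      ext i; fin_cases i <;> simp [val_shiftGL, Subring.smul_def]
  · exact (ray_zero F).symm
  · exact (ray_eq_toVertex 1).symm

theorem IsEdge.exists_smul_ray {v w : Vertex F} (h : IsEdge v w) :
    ∃ g : PGL(2, F), g • ray F 0 = v ∧ g • ray F 1 = w := by
  obtain ⟨L, M, e, ϖ, hϖ, hL, hM, rfl, rfl⟩ := h
  refine ⟨Matrix.ProjGenLinGroup.mk (basisGL e), ?_, ?_⟩
  · rw [ray_zero]
    refine (mk_smul_toVertex _ _).trans (congrArg _ (Subtype.ext ?_))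
    rw [basisGL_smul_stdLattice, hL]
  · rw [ray_eq_toVertex]
    refine (mk_smul_toVertex _ _).trans (congrArg _ (Subtype.ext ?_))
    rw [← mul_smul, smul_stdLattice, Units.val_mul, ← Matrix.mulVec_mulVec,
      ← Matrix.mulVec_mulVec, basisGL_mulVec, basisGL_mulVec, hM]
    -- The edge comes with its own uniformizer; it differs from the fixed one by a unit, which does
    -- not change the span.
    obtain ⟨u, hu⟩ := IsDiscreteValuationRing.associated_of_irreducible 𝒪[F] hϖ
      (unif_irreducible F)
    have hu' : (ϖ : F) * (u : 𝒪[F]) = unif F := congrArg Subtype.val hu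
    have hv : unif F * (↑u⁻¹ : 𝒪[F]) = ϖ := by rw [← hu]; simp
    have key : (unif F : F) • e 1 = u.1 • ϖ • e 1 := by
      rw [← mul_smul, mul_comm, hu]; rfl
    simp only [val_shiftGL, Matrix.mulVec_single_one, Matrix.col_apply, Matrix.of_apply,
      Matrix.cons_val_zero, Matrix.cons_val_one, one_smul, zero_smul, add_zero, zero_add, pow_one,
      Matrix.cons_val', Matrix.cons_val_fin_one]
    rw [key]
    ext x
    simp only [Submodule.mem_span_pair]
    constructor
    · rintro ⟨a, b, rfl⟩
      exact ⟨a, b * u, by module⟩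
    · rintro ⟨a, b, rfl⟩
      refine ⟨a, b * (↑u⁻¹ : 𝒪[F]), ?_⟩
      rw [← mul_smul (b * (↑u⁻¹ : 𝒪[F])), mul_assoc]
      simp

omit [TopologicalSpace F] [IsNonarchimedeanLocalField F] in
/-- Iwasawa decomposition. -/
theorem exists_intGL_mul_borel (g : PGL(2, F)) : ∃ k, ∃ b ∈ borel F, g = intGL F k * b := by
  obtain ⟨g, rfl⟩ := Matrix.ProjGenLinGroup.mk_surjective g
  suffices ∃ k : GL (Fin 2) 𝒪[F],
      (Matrix.GeneralLinearGroup.map (algebraMap 𝒪[F] F) k * g) 1 0 = 0 by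
    obtain ⟨k, hk⟩ := this
    refine ⟨k⁻¹, _, ⟨_, hk, rfl⟩, ?_⟩
    rw [map_inv, eq_inv_mul_iff_mul_eq]
    simp [intGL]
  rcases mem_integer_or_inv_mem F (g 1 0 / g 0 0) with h | h
  · by_cases h0 : g 0 0 = 0
    · exact ⟨swapGL _, by simp [swapGL, Matrix.mul_apply, h0]⟩
    · refine ⟨lowerGL (-⟨_, h⟩), ?_⟩
      simp [lowerGL, Matrix.mul_apply, algebraMap_integer]
      change -(g 1 0 / g 0 0 * g 0 0) + g 1 0 = 0
      field_simp
      simp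
  · rw [inv_div] at h
    by_cases h0 : g 1 0 = 0
    · exact ⟨1, by simp [h0]⟩
    · refine ⟨lowerGL (-⟨_, h⟩) * swapGL _, ?_⟩
      simp [lowerGL, swapGL, Matrix.mul_apply, algebraMap_integer]
      change g 0 0 + -(g 0 0 / g 1 0 * g 1 0) = 0
      field_simp
      simp

/-- Placing powers of `ϖ` on both sides covers negative valuations with natural exponents only. -/
theorem exists_mul_pow_eq {r : F} (hr : r ≠ 0) :
    ∃ (u : 𝒪[F]ˣ) (i j : ℕ), r * (unif F : F) ^ i = (u : 𝒪[F]) * (unif F : F) ^ j := by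
  have h0 := unif_ne_zero F
  rcases mem_integer_or_inv_mem F r with h | h
  · obtain ⟨n, u, hu⟩ := IsDiscreteValuationRing.eq_unit_mul_pow_irreducible
      (x := (⟨r, h⟩ : 𝒪[F])) (fun h => hr (congrArg Subtype.val h)) (unif_irreducible F)
    exact ⟨u, 0, n, by simpa using congrArg Subtype.val hu⟩
  · obtain ⟨n, u, hu⟩ := IsDiscreteValuationRing.eq_unit_mul_pow_irreducible
      (x := (⟨r⁻¹, h⟩ : 𝒪[F])) (fun h => inv_ne_zero hr (congrArg Subtype.val h))
      (unif_irreducible F)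
    refine ⟨u⁻¹, n, 0, ?_⟩
    have hu' : r⁻¹ = (u : 𝒪[F]) * (unif F : F) ^ n := by simpa using congrArg Subtype.val hu
    have hu1 : ((↑u⁻¹ : 𝒪[F]) : F) * (u : 𝒪[F]) = 1 := congrArg Subtype.val u.inv_mul
    rw [pow_zero, mul_one, ← one_mul (r * _), ← hu1, mul_assoc, ← mul_left_comm r, ← hu',
      mul_inv_cancel₀ hr, mul_one]

/-- Elements of the Borel subgroup fix the end defined by the standard ray. -/
theorem exists_borel_smul_ray {b : PGL(2, F)} (hb : b ∈ borel F) :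
    ∃ N M, ∀ n, b • ray F (n + N) = ray F (n + M) := by
  obtain ⟨b, hb, rfl⟩ := hb
  replace hb : b 1 0 = 0 := hb
  have hdet : b 0 0 * b 1 1 ≠ 0 := by
    have := (isUnit_det_GL b).ne_zero
    simpa [hb] using this
  have ha : b 0 0 ≠ 0 := left_ne_zero_of_mul hdet
  obtain ⟨u, i, j, hij⟩ := exists_mul_pow_eq (div_ne_zero (right_ne_zero_of_mul hdet) ha)
  obtain ⟨l, hl⟩ : ∃ l : ℕ, b 0 1 / b 0 0 * (unif F : F) ^ l ∈ 𝒪[F] := by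
    by_cases h : b 0 1 / b 0 0 = 0
    · exact ⟨0, by simp [h]⟩
    · obtain ⟨u, i, j, hij⟩ := exists_mul_pow_eq h
      refine ⟨i, ?_⟩
      rw [hij]
      exact (u * unif F ^ j : 𝒪[F]).2
  -- The shift `j - i` is the valuation of the ratio of the diagonal entries. Starting at least `l`
  -- further out clears the denominator of the off-diagonal entry, so that the remaining factor `k`
  -- is integral.
  refine ⟨i + l, j + l, fun n => ?_⟩
  let k : GL (Fin 2) 𝒪[F] := Matrix.GeneralLinearGroup.mk''
    !![1, ⟨_, hl⟩ * unif F ^ (n + i); 0, u] (by simp [Matrix.det_fin_two])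
  have hk : Matrix.ProjGenLinGroup.mk b * shift F (n + (i + l)) =
      shift F (n + (j + l)) * intGL F k := by
    simp only [intGL, shift, MonoidHom.comp_apply, ← map_mul]
    refine mk_eq_mk_of_smul ha ?_
    rw [Units.val_mul, Units.val_mul]
    have h1 : b 1 1 * (unif F : F) ^ (n + (i + l)) =
        b 0 0 * ((unif F : F) ^ (n + (j + l)) * (u : 𝒪[F])) := by
      rw [div_mul_eq_mul_div, div_eq_iff ha] at hij
      linear_combination (unif F : F) ^ (n + l) * hij
    have h2 : b 0 1 * (unif F : F) ^ (n + (i + l)) =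
        b 0 0 * (b 0 1 / b 0 0 * (unif F : F) ^ l * (unif F : F) ^ (n + i)) := by
      field_simp
      ring
    ext s t
    fin_cases s <;> fin_cases t <;>
      simp [val_shiftGL, Matrix.mul_apply, Matrix.vecMul, dotProduct, k, hb, algebraMap_integer]
    · exact h2
    · exact h1
  rw [ray, ← mul_smul, hk, mul_smul, intGL_smul_baseVertex, ray]

/-- Cartan decomposition. -/
theorem exists_cartan (g : PGL(2, F)) : ∃ k n k', g = intGL F k * shift F n * intGL F k' := by
  -- When the corner entry divides all others, Gaussian elimination with that pivot has integral
  -- multipliers; the power of `ϖ` is read off the Schur complement `d`.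
  have main : ∀ A : GL (Fin 2) F, (∀ i j, A i j / A 0 0 ∈ 𝒪[F]) → A 0 0 ≠ 0 →
      ∃ k n k', Matrix.ProjGenLinGroup.mk A = intGL F k * shift F n * intGL F k' := by
    intro A hA h0
    have hdet := (isUnit_det_GL A).ne_zero
    let d : 𝒪[F] := ⟨_, hA 1 1⟩ - ⟨_, hA 1 0⟩ * ⟨_, hA 0 1⟩
    have hd : d ≠ 0 := by
      intro h
      apply hdet
      have h' : A 1 1 / A 0 0 - A 1 0 / A 0 0 * (A 0 1 / A 0 0) = 0 := congrArg Subtype.val h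
      field_simp at h'
      linear_combination h'
    obtain ⟨n, u, hu⟩ := IsDiscreteValuationRing.eq_unit_mul_pow_irreducible hd
      (unif_irreducible F)
    refine ⟨lowerGL ⟨_, hA 1 0⟩, n, Matrix.GeneralLinearGroup.mk'' !![1, ⟨_, hA 0 1⟩; 0, u]
      (by simp [Matrix.det_fin_two]), ?_⟩
    simp only [intGL, shift, MonoidHom.comp_apply, ← map_mul]
    refine mk_eq_mk_of_smul h0 ?_
    have hu' : A 1 1 / A 0 0 - A 1 0 / A 0 0 * (A 0 1 / A 0 0) =
      (u : 𝒪[F]) * (unif F : F) ^ n := congrArg Subtype.val hu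
    have e01 : A 0 1 = A 0 0 * (A 0 1 / A 0 0) := by field_simp
    have e10 : A 1 0 = A 0 0 * (A 1 0 / A 0 0) := by field_simp
    have e11 : A 1 1 = A 0 0 * (A 1 0 / A 0 0 * (A 0 1 / A 0 0) +
      (unif F : F) ^ n * (u : 𝒪[F])) := by
      rw [mul_comm _ ((u : 𝒪[F]) : F), ← hu']; field_simp; ring
    rw [Units.val_mul, Units.val_mul]
    ext s t
    fin_cases s <;> fin_cases t <;> simp [val_shiftGL, Matrix.mul_apply, lowerGL]
    · exact e01
    · exact e10
    · exact e11
  obtain ⟨A, rfl⟩ := Matrix.ProjGenLinGroup.mk_surjective g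
  obtain ⟨p, hp⟩ := Finite.exists_max
    (fun p : Fin 2 × Fin 2 => ValuativeRel.valuation F (A p.1 p.2))
  have h0 : A p.1 p.2 ≠ 0 := by
    intro h
    have h' : ∀ i j, A i j = 0 := fun i j => by
      have := hp (i, j)
      rw [h, map_zero] at this
      simpa using this
    exact (isUnit_det_GL A).ne_zero (by simp [h'])
  have hint : ∀ i j, A i j / A p.1 p.2 ∈ 𝒪[F] := fun i j => by
    rw [Valuation.mem_integer_iff, map_div₀]
    exact div_le_one_of_le₀ (hp (i, j)) zero_le
  -- In general an entry of largest valuation is moved to the corner by row and column swaps, which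
  -- lie in `GL(2, 𝒪)`.
  let s : Fin 2 → GL (Fin 2) 𝒪[F] := fun i => if i = 0 then 1 else swapGL _
  have hs : ∀ i, s i * s i = 1 := fun i => by
    fin_cases i <;> simp [s, swapGL_mul_self]
  let f := Matrix.GeneralLinearGroup.map (n := Fin 2) (algebraMap 𝒪[F] F)
  have hB : ∀ i j, (f (s p.1) * A * f (s p.2)) i j =
      A (if p.1 = 0 then i else 1 - i) (if p.2 = 0 then j else 1 - j) := by
    obtain ⟨p, q⟩ := p
    intro i j
    fin_cases p <;> fin_cases q <;> fin_cases i <;> fin_cases j <;>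
      simp [s, f, swapGL, Matrix.mul_apply]
  have hB0 : (f (s p.1) * A * f (s p.2)) 0 0 = A p.1 p.2 := by
    rw [hB]
    obtain ⟨p, q⟩ := p
    fin_cases p <;> fin_cases q <;> rfl
  obtain ⟨k, n, k', h⟩ := main (f (s p.1) * A * f (s p.2))
    (fun i j => by rw [hB, hB0]; exact hint _ _) (by rwa [hB0])
  refine ⟨s p.1 * k, n, k' * s p.2, ?_⟩
  have h1 : intGL F (s p.1) * (Matrix.ProjGenLinGroup.mk (f (s p.1) * A * f (s p.2))) *
      intGL F (s p.2) = Matrix.ProjGenLinGroup.mk A := by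
    have h2 : ∀ i, f (s i) * f (s i) = 1 := fun i => by rw [← map_mul, hs, map_one]
    simp only [intGL, MonoidHom.comp_apply, ← map_mul]
    congr 1
    change f (s p.1) * (f (s p.1) * A * f (s p.2)) * f (s p.2) = A
    rw [mul_assoc, mul_assoc, mul_assoc, h2, mul_one, ← mul_assoc, h2, one_mul]
  rw [← h1, h, map_mul, map_mul]
  simp only [mul_assoc]

theorem exists_eq_intGL_smul_ray (v : Vertex F) : ∃ k n, v = intGL F k • ray F n := by
  obtain ⟨g, rfl⟩ := exists_smul_baseVertex v
  obtain ⟨k, n, k', rfl⟩ := exists_cartan g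
  exact ⟨k, n, by rw [mul_smul, intGL_smul_baseVertex, mul_smul, ray]⟩

theorem shift_mul_lowerGL (n : ℕ) (x : 𝒪[F]) :
    shift F n * intGL F (lowerGL x) = intGL F (lowerGL (unif F ^ n * x)) * shift F n := by
  simp only [intGL, shift, MonoidHom.comp_apply, ← map_mul]
  refine congrArg _ (Units.ext ?_)
  rw [Units.val_mul, Units.val_mul]
  ext i j
  fin_cases i <;> fin_cases j <;> simp [val_shiftGL, Matrix.mul_apply, lowerGL, algebraMap_integer]

/-- The two matrices differ by the scalar `ϖ`. Applied to the base vertex, this says that the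
swapped direction at `ray (n + 1)` leads back to `ray n`. -/
theorem shift_succ_mul_swapGL_mul_shift (n : ℕ) :
    shift F (n + 1) * intGL F (swapGL _) * shift F 1 = shift F n * intGL F (swapGL _) := by
  simp only [intGL, shift, MonoidHom.comp_apply, ← map_mul]
  refine mk_eq_mk_of_smul (unif_ne_zero F) ?_
  rw [Units.val_mul, Units.val_mul, Units.val_mul]
  ext i j
  fin_cases i <;> fin_cases j <;>
    simp [val_shiftGL, Matrix.mul_apply, Matrix.vecMul, dotProduct, swapGL, pow_succ']

/-- Up to orientation, every edge is a translate of an edge of the standard ray under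
`GL(2, 𝒪)`. -/
theorem IsEdge.exists_intGL {v w : Vertex F} (h : IsEdge v w) : ∃ k n,
    (v = intGL F k • ray F n ∧ w = intGL F k • ray F (n + 1)) ∨
      (w = intGL F k • ray F n ∧ v = intGL F k • ray F (n + 1)) := by
  obtain ⟨g, hv, rfl⟩ := h.exists_smul_ray
  obtain ⟨k, n, rfl⟩ := exists_eq_intGL_smul_ray v
  have h1 : ((intGL F k * shift F n)⁻¹ * g) • baseVertex F = baseVertex F := by
    rw [mul_smul, inv_smul_eq_iff, mul_smul, ← ray_zero, hv, ray_zero, ray]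
  obtain ⟨k', hk'⟩ := smul_baseVertex_eq_iff.1 h1
  rw [eq_inv_mul_iff_mul_eq] at hk'
  subst hk'
  rw [mul_smul, mul_smul]
  -- The neighbours of a vertex correspond to points of the projective line over the residue field,
  -- here the first column of `k'` modulo `ϖ`. Points with invertible first coordinate are reached
  -- by lower unitriangular matrices and lead away from the base vertex.
  by_cases hu : IsUnit (k' 0 0)
  · obtain ⟨u, hu⟩ := hu
    have h2 : intGL F k' • ray F 1 = intGL F (lowerGL (k' 1 0 * (↑u⁻¹ : 𝒪[F]))) • ray F 1 := by
      rw [← inv_smul_eq_iff, ← mul_smul, ← map_inv, ← map_mul, inv_lowerGL,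
        intGL_smul_ray_iff]
      refine ⟨rfl, ?_⟩
      simp [lowerGL, Matrix.mul_apply, mul_assoc, ← hu]
    refine ⟨k * lowerGL (unif F ^ n * (k' 1 0 * (↑u⁻¹ : 𝒪[F]))), n, Or.inl ⟨?_, ?_⟩⟩
    · rw [map_mul, mul_smul, (intGL_smul_ray_iff (k := lowerGL _) (n := n) (m := n)).2
        ⟨rfl, by simp [lowerGL]⟩]
    · rw [h2, ← mul_smul (shift F n), shift_mul_lowerGL, mul_smul, shift_smul_ray, map_mul, mul_smul]
  · have h2 : intGL F k' • ray F 1 = intGL F (swapGL _) • ray F 1 := by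
      rw [← inv_smul_eq_iff, ← mul_smul, ← map_inv, ← map_mul, inv_swapGL,
        intGL_smul_ray_iff]
      refine ⟨rfl, ?_⟩
      have h3 : k' 0 0 ∈ IsLocalRing.maximalIdeal 𝒪[F] := hu
      rw [(unif_irreducible F).maximalIdeal_eq, Ideal.mem_span_singleton] at h3
      simpa [swapGL, Matrix.mul_apply] using h3
    rw [h2]
    -- The remaining point is the swapped direction. At the base vertex it is a step outwards like
    -- any other; elsewhere it is the step back, which is why the orientation is reversed.
    rcases n with - | n
    · refine ⟨k * swapGL _, 0, Or.inl ⟨?_, ?_⟩⟩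
      · rw [map_mul, mul_smul, ray_zero, intGL_smul_baseVertex (swapGL _)]
      · rw [shift_zero, one_smul, map_mul, mul_smul]
    · refine ⟨k, n, Or.inr ⟨?_, rfl⟩⟩
      rw [show ray F 1 = shift F 1 • baseVertex F from rfl, ← mul_smul (intGL F (swapGL _)),
        ← mul_smul (shift F (n + 1)), ← mul_assoc, shift_succ_mul_swapGL_mul_shift,
        mul_smul (shift F n), intGL_smul_baseVertex, ray]

end Orbits

/-! ### Open stabilizers and congruence subgroups. -/

section Topology

variable {F : Type*} [Field F] [ValuativeRel F] [TopologicalSpace F]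
  [IsNonarchimedeanLocalField F]

theorem isOpenMap_mk : IsOpenMap (Matrix.ProjGenLinGroup.mk : GL (Fin 2) F → PGL(2, F)) :=
  QuotientGroup.isOpenMap_coe (N := Subgroup.center (GL (Fin 2) F))

omit [ValuativeRel F] [IsNonarchimedeanLocalField F] in
theorem continuous_mk : Continuous (Matrix.ProjGenLinGroup.mk : GL (Fin 2) F → PGL(2, F)) :=
  continuous_quot_mk

theorem isOpen_range_intGL : IsOpen (Set.range (intGL F)) := by
  have hO : IsOpen (𝒪[F] : Set F) := Valuation.isOpen_integer
  have h1 : IsOpen {g : GL (Fin 2) F | ∀ i j, g i j ∈ 𝒪[F] ∧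
      ((g⁻¹ : GL (Fin 2) F) : Matrix (Fin 2) (Fin 2) F) i j ∈ 𝒪[F]} := by
    simp only [Set.ofPred_forall, Set.ofPred_and]
    refine isOpen_iInter_of_finite fun i => isOpen_iInter_of_finite fun j =>
      IsOpen.inter (hO.preimage ?_) (hO.preimage ?_)
    · exact Units.continuous_val.matrix_elem i j
    · exact (Units.continuous_val.comp continuous_inv).matrix_elem i j
  convert! isOpenMap_mk _ h1 using 1
  ext x
  constructor
  · rintro ⟨k, rfl⟩
    refine ⟨_, fun i j => ⟨(k i j).2, ?_⟩, rfl⟩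
    rw [← map_inv]
    exact ((k⁻¹ : GL (Fin 2) 𝒪[F]) i j).2
  · rintro ⟨g, hg, rfl⟩
    obtain ⟨k, rfl⟩ := exists_lift_of_integral (fun i j => (hg i j).1) (fun i j => (hg i j).2)
    exact ⟨k, rfl⟩

theorem isOpen_stabilizer_vertex (v : Vertex F) :
    IsOpen (MulAction.stabilizer PGL(2, F) v : Set PGL(2, F)) := by
  obtain ⟨g, rfl⟩ := exists_smul_baseVertex v
  have h : (MulAction.stabilizer PGL(2, F) (g • baseVertex F) : Set PGL(2, F)) =
      (fun h => g⁻¹ * h * g) ⁻¹' Set.range (intGL F) := by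
    ext h
    rw [SetLike.mem_coe, MulAction.mem_stabilizer_iff, Set.mem_preimage, Set.mem_range,
      ← smul_baseVertex_eq_iff, mul_smul, mul_smul, inv_smul_eq_iff]
  rw [h]
  exact isOpen_range_intGL.preimage (by fun_prop)

theorem isOpen_fixingSubgroup {s : Set (Vertex F)} (hs : s.Finite) :
    IsOpen (fixingSubgroup PGL(2, F) s : Set PGL(2, F)) := by
  have h : (fixingSubgroup PGL(2, F) s : Set PGL(2, F)) =
      ⋂ v ∈ s, (MulAction.stabilizer PGL(2, F) v : Set PGL(2, F)) := by
    ext g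
    simp [mem_fixingSubgroup_iff]
  rw [h]
  exact hs.isOpen_biInter fun v _ => isOpen_stabilizer_vertex v

theorem exists_unif_pow_mem {S : Set F} (hS : S ∈ nhds (0 : F)) :
    ∃ N, ∀ n ≥ N, ∀ x : 𝒪[F], unif F ^ n ∣ x → (x : F) ∈ S := by
  obtain ⟨γ, hγ, h⟩ := (IsValuativeTopology.hasBasis_nhds_zero' F).mem_iff.1 hS
  obtain ⟨r, rfl⟩ := ValuativeRel.valuation_surjective γ
  have hr : r ≠ 0 := by
    rintro rfl
    simp at hγ
  obtain ⟨u, i, j, hij⟩ := exists_mul_pow_eq hr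
  have hp : ValuativeRel.valuation F (unif F) < 1 :=
    Valuation.Integer.not_isUnit_iff_valuation_lt_one.1 (unif_irreducible F).not_isUnit
  have hp0 : 0 < ValuativeRel.valuation F (unif F) := by
    rw [Valuation.pos_iff]
    exact unif_ne_zero F
  have hu : ValuativeRel.valuation F (u : 𝒪[F]) = 1 :=
    (Valuation.integer.integers (ValuativeRel.valuation F)).one_of_isUnit u.isUnit
  -- The valuation of `ϖ ^ j` is at most that of `r`; the additional factor `ϖ` makes the inequality
  -- strict.
  refine ⟨j + 1, fun n hn x hx => h ?_⟩
  obtain ⟨y, rfl⟩ := (pow_dvd_pow _ hn).trans hx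
  change ValuativeRel.valuation F (unif F ^ (j + 1) * y : 𝒪[F]) < _
  have h1 := congrArg (ValuativeRel.valuation F) hij
  rw [map_mul, map_mul, map_pow, map_pow, hu, one_mul] at h1
  push_cast
  rw [map_mul, map_pow]
  calc _ ≤ ValuativeRel.valuation F (unif F) ^ (j + 1) * 1 := by gcongr; exact y.2
    _ < ValuativeRel.valuation F (unif F) ^ j := by
      rw [mul_one, pow_succ]
      exact mul_lt_of_lt_one_right (pow_pos hp0 _) hp
    _ ≤ _ := by
      rw [← h1]
      exact mul_le_of_le_one_right' (pow_le_one' hp.le _)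

theorem exists_unif_pow_matrix_mem {A : Fin 2 → Fin 2 → F}
    {W : Set (Fin 2 → Fin 2 → F)} (hW : W ∈ nhds A) :
    ∃ N, ∀ n ≥ N, ∀ B : Fin 2 → Fin 2 → F,
      (∀ i j, ∃ x : 𝒪[F], unif F ^ n ∣ x ∧ B i j = A i j + x) → B ∈ W := by
  have h : ∃ t : Fin 2 → Fin 2 → Set F, (∀ i j, t i j ∈ nhds (A i j)) ∧
      {B | ∀ i j, B i j ∈ t i j} ⊆ W := by
    rw [nhds_pi, Filter.mem_pi'] at hW
    obtain ⟨I, t, ht, hI⟩ := hW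
    have : ∀ i, ∃ s : Fin 2 → Set F, (∀ j, s j ∈ nhds (A i j)) ∧ Set.univ.pi s ⊆ t i := by
      intro i
      have := ht i
      rw [nhds_pi, Filter.mem_pi'] at this
      obtain ⟨J, s, hs, hJ⟩ := this
      exact ⟨s, hs, (Set.pi_mono' (fun _ _ => le_rfl) (Set.subset_univ _)).trans hJ⟩
    choose s hs hst using this
    refine ⟨s, hs, fun B hB => hI fun i _ => hst i fun j _ => hB i j⟩
  obtain ⟨t, ht, htW⟩ := h
  have h2 : ∀ i j, ∃ N, ∀ n ≥ N, ∀ x : 𝒪[F], unif F ^ n ∣ x → A i j + x ∈ t i j := by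
    intro i j
    refine exists_unif_pow_mem (S := (fun x => A i j + x) ⁻¹' t i j) ?_
    refine (continuous_const.add continuous_id).continuousAt.preimage_mem_nhds ?_
    simpa using ht i j
  choose N hN using h2
  refine ⟨Finset.univ.sup fun p : Fin 2 × Fin 2 => N p.1 p.2, fun n hn B hB => htW fun i j => ?_⟩
  obtain ⟨x, hx, hB⟩ := hB i j
  rw [hB]
  exact hN i j n ((Finset.le_sup (f := fun p : Fin 2 × Fin 2 => N p.1 p.2)
    (Finset.mem_univ (i, j))).trans hn) x hx

variable (F) in
/-- The principal congruence subgroup of level `ϖⁿ`. -/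
def congruenceSubgroup (n : ℕ) : Subgroup (GL (Fin 2) 𝒪[F]) :=
  (Matrix.GeneralLinearGroup.map (Ideal.Quotient.mk (Ideal.span {unif F ^ n}))).ker

instance (n : ℕ) : (congruenceSubgroup F n).Normal :=
  inferInstanceAs (MonoidHom.ker _).Normal

theorem mem_congruenceSubgroup {n : ℕ} {k : GL (Fin 2) 𝒪[F]} :
    k ∈ congruenceSubgroup F n ↔
      ∀ i j, unif F ^ n ∣ k i j - (1 : Matrix (Fin 2) (Fin 2) 𝒪[F]) i j := by
  rw [congruenceSubgroup, MonoidHom.mem_ker, Units.ext_iff, ← Matrix.ext_iff]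
  refine forall_congr' fun i => forall_congr' fun j => ?_
  rw [← Ideal.mem_span_singleton, ← Ideal.Quotient.eq_zero_iff_mem, map_sub, sub_eq_zero]
  refine Eq.congr rfl ?_
  rw [Units.val_one, Matrix.one_apply, Matrix.one_apply]
  split_ifs <;> simp

/-- The topology of `GL(2, F)` controls a matrix together with its inverse. Closeness of the inverse
costs nothing, since the congruence conditions define a subgroup. -/
theorem exists_congruenceSubgroup_le {U : Subgroup PGL(2, F)} (hU : IsOpen (U : Set PGL(2, F))) :
    ∃ N, ∀ n ≥ N, ∀ k ∈ congruenceSubgroup F n, intGL F k ∈ U := by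
  have h1 : Matrix.ProjGenLinGroup.mk ⁻¹' (U : Set PGL(2, F)) ∈ nhds (1 : GL (Fin 2) F) :=
    (hU.preimage continuous_mk).mem_nhds (by simp [U.one_mem])
  rw [Units.isEmbedding_embedProduct.nhds_eq_comap, Filter.mem_comap] at h1
  obtain ⟨T, hT, hTU⟩ := h1
  rw [map_one, Prod.one_eq_mk, nhds_prod_eq, Filter.mem_prod_iff] at hT
  obtain ⟨W, hW, W', hW', hWT⟩ := hT
  have hW'' : MulOpposite.op ⁻¹' W' ∈ nhds (1 : Matrix (Fin 2) (Fin 2) F) :=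
    MulOpposite.continuous_op.continuousAt.preimage_mem_nhds hW'
  obtain ⟨N, hN⟩ := exists_unif_pow_matrix_mem (Filter.inter_mem hW hW'')
  refine ⟨N, fun n hn k hk => hTU (hWT ⟨?_, ?_⟩)⟩
  all_goals
    have key : ∀ k ∈ congruenceSubgroup F n,
        ((Matrix.GeneralLinearGroup.map (algebraMap 𝒪[F] F) k : GL (Fin 2) F) :
          Matrix (Fin 2) (Fin 2) F) ∈ W ∩ MulOpposite.op ⁻¹' W' := by
      intro k hk
      refine hN n hn _ fun i j => ⟨_, mem_congruenceSubgroup.1 hk i j, ?_⟩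
      rw [Matrix.one_apply, Matrix.one_apply]
      split_ifs <;> simp [algebraMap_integer]
  · exact (key k hk).1
  · have := (key k⁻¹ (inv_mem hk)).2
    rw [map_inv] at this
    exact this

omit [TopologicalSpace F] [IsNonarchimedeanLocalField F] in
theorem upperTriangular_mem_borel {k : GL (Fin 2) 𝒪[F]} (hk : k 1 0 = 0) :
    intGL F k ∈ borel F :=
  ⟨_, by
    change algebraMap 𝒪[F] F (k 1 0) = 0
    rw [hk, map_zero], rfl⟩

theorem isUnit_apply_zero_zero {k : GL (Fin 2) 𝒪[F]} {n : ℕ} (hn : n ≠ 0)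
    (hk : unif F ^ n ∣ k 1 0) : IsUnit (k 0 0) := by
  by_contra h
  have h1 : unif F ∣ k 0 0 := by
    have h3 : k 0 0 ∈ IsLocalRing.maximalIdeal 𝒪[F] := h
    rwa [(unif_irreducible F).maximalIdeal_eq, Ideal.mem_span_singleton] at h3
  have h2 : unif F ∣ k 1 0 := (dvd_pow_self _ hn).trans hk
  exact (unif_irreducible F).not_isUnit (isUnit_of_dvd_unit
    (dvd_sub (dvd_mul_of_dvd_left h1 _) (dvd_mul_of_dvd_right h2 _)) (isUnit_det_GL k))

/-- A smooth left `B`-invariant function depends, at `k⁻¹` with `k ∈ GL(2, 𝒪)`, only on the vertex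
`k • ray n` for large `n`. -/
theorem eq_of_smul_ray_eq {Φ : PGL(2, F) → ℂ} (hB : ∀ b ∈ borel F, ∀ g, Φ (b * g) = Φ g)
    {U : Subgroup PGL(2, F)} (hU : ∀ g, ∀ u ∈ U, Φ (g * u) = Φ g) {n : ℕ} (hn : n ≠ 0)
    (hn' : ∀ k ∈ congruenceSubgroup F n, intGL F k ∈ U) {k k' : GL (Fin 2) 𝒪[F]}
    (h : intGL F k • ray F n = intGL F k' • ray F n) :
    Φ (intGL F k)⁻¹ = Φ (intGL F k')⁻¹ := by
  obtain ⟨s, rfl⟩ : ∃ s, k = k' * s := ⟨k'⁻¹ * k, by group⟩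
  rw [map_mul, mul_smul, smul_left_cancel_iff, intGL_smul_ray_iff] at h
  obtain ⟨u, hu⟩ := isUnit_apply_zero_zero hn h.2
  obtain ⟨x, hx⟩ : ∃ x, x = s 1 0 * (↑u⁻¹ : 𝒪[F]) := ⟨_, rfl⟩
  have hxs : x * s 0 0 = s 1 0 := by rw [hx, ← hu, mul_assoc, Units.inv_mul, mul_one]
  obtain ⟨t, rfl⟩ : ∃ t, s = lowerGL x * t := ⟨(lowerGL x)⁻¹ * s, by group⟩
  have ht : t 1 0 = 0 := by
    simpa [lowerGL, Matrix.mul_apply] using hxs.symm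
  -- With `s = lowerGL x * t`, the inverse of `k' * s` is `t⁻¹` times `k'⁻¹` times this conjugate.
  -- The upper triangular `t⁻¹` is absorbed on the left by `B`-invariance, the conjugate on the
  -- right by smoothness; normality of the congruence subgroup makes this work for every `k'`.
  have hc : k' * lowerGL (-x) * k'⁻¹ ∈ congruenceSubgroup F n := by
    refine Subgroup.Normal.conj_mem inferInstance _ (mem_congruenceSubgroup.2 fun i j => ?_) _
    have hxn : unif F ^ n ∣ x := hx ▸ dvd_mul_of_dvd_left h.2 _
    fin_cases i <;> fin_cases j <;> simp [lowerGL, hxn]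
  have e : (intGL F (k' * (lowerGL x * t)))⁻¹ =
      intGL F t⁻¹ * ((intGL F k')⁻¹ * intGL F (k' * lowerGL (-x) * k'⁻¹)) := by
    simp only [← map_inv, ← map_mul, ← inv_lowerGL]
    congr 1
    group
  rw [e, hB _ ?_, hU _ _ (hn' _ hc)]
  rw [map_inv]
  exact inv_mem (upperTriangular_mem_borel ht)

end Topology

/-! ### The Iwahori subgroup and its normalizer as stabilizers of an edge. -/

section Iwahori

variable {F : Type*} [Field F] [ValuativeRel F] [TopologicalSpace F]
  [IsNonarchimedeanLocalField F]

theorem ray_injective : Function.Injective (ray F) := fun n m h => by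
  refine ((intGL_smul_ray_iff (F := F) (k := 1)).1 ?_).1
  rw [map_one, one_smul, h]

/-- Fixing `ray 0` means lying in the image of `GL(2, 𝒪)`, and fixing `ray 1` then means that the
lower left entry vanishes modulo `ϖ`. -/
theorem mem_iwahori_iff {g : PGL(2, F)} :
    g ∈ iwahori F ↔ g • ray F 0 = ray F 0 ∧ g • ray F 1 = ray F 1 := by
  have key : ∀ k : GL (Fin 2) 𝒪[F], (unif F ^ 1 ∣ k 1 0) ↔
      k ∈ (upperTriangular 𝓀[F]).comap
        (Matrix.GeneralLinearGroup.map (IsLocalRing.residue 𝒪[F])) := by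
    intro k
    change _ ↔ IsLocalRing.residue 𝒪[F] (k 1 0) = 0
    rw [IsLocalRing.residue_eq_zero_iff, (unif_irreducible F).maximalIdeal_eq,
      Ideal.mem_span_singleton, pow_one]
  constructor
  · rintro ⟨_, ⟨k, hk, rfl⟩, rfl⟩
    have h := (key k).2 hk
    refine ⟨?_, (intGL_smul_ray_iff (k := k)).2 ⟨rfl, h⟩⟩
    rw [ray_zero]
    exact intGL_smul_baseVertex k
  · rintro ⟨h0, h1⟩
    rw [ray_zero, smul_baseVertex_eq_iff] at h0
    obtain ⟨k, rfl⟩ := h0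
    exact ⟨_, ⟨k, (key k).1 (intGL_smul_ray_iff.1 h1).2, rfl⟩, rfl⟩

/-- Two unipotent elements suffice as tests on `v = k • ray n`. The upper one with entry `1` gives
`ϖⁿ ∣ (k 1 0)²`, the lower one with entry `ϖ` gives `ϖⁿ ∣ ϖ (k 0 0)²`. As the first column of `k`
contains a unit, these leave only the two ends of the standard edge. -/
theorem eq_ray_of_iwahori_fixed {v : Vertex F} (hv : ∀ g ∈ iwahori F, g • v = v) :
    v = ray F 0 ∨ v = ray F 1 := by
  obtain ⟨k, n, rfl⟩ := exists_eq_intGL_smul_ray v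
  have hd := isUnit_det_GL k
  -- The expression is the determinant of `k` times the lower left entry of `k⁻¹ * h * k`.
  have key : ∀ h : GL (Fin 2) 𝒪[F], unif F ∣ h 1 0 →
      unif F ^ n ∣ k 0 0 * (h * k) 1 0 - k 1 0 * (h * k) 0 0 := by
    intro h hh
    have hI : intGL F h ∈ iwahori F := by
      rw [mem_iwahori_iff, intGL_smul_ray_iff, intGL_smul_ray_iff]
      simpa using hh
    have h1 := hv _ hI
    obtain ⟨m, hm⟩ : ∃ m, h * k = k * m := ⟨k⁻¹ * (h * k), by group⟩
    rw [← mul_smul, ← map_mul, hm, map_mul, mul_smul, smul_left_cancel_iff,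
      intGL_smul_ray_iff] at h1
    rw [hm]
    convert! dvd_mul_of_dvd_right h1.2 (k 0 0 * k 1 1 - k 0 1 * k 1 0) using 1
    simp only [Units.val_mul, Matrix.mul_apply, Fin.sum_univ_two]
    ring
  have hc : unif F ^ n ∣ k 1 0 ^ 2 := by
    have := key (Matrix.GeneralLinearGroup.mk'' !![1, 1; 0, 1] (by simp [Matrix.det_fin_two]))
      (by simp)
    rw [← dvd_neg]
    convert! this using 1
    simp [Matrix.mul_apply]
    ring
  have ha : unif F ^ n ∣ unif F * k 0 0 ^ 2 := by
    have := key (lowerGL (unif F)) (by simp [lowerGL])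
    convert! this using 1
    simp [Matrix.mul_apply, lowerGL]
    ring
  by_cases hu : IsUnit (k 0 0)
  · rw [(hu.pow 2).dvd_mul_right] at ha
    have hn : n ≤ 1 := by
      rw [← unif_pow_dvd_unif_pow (F := F), pow_one]
      exact ha
    interval_cases n
    · left
      rw [ray_zero, intGL_smul_baseVertex]
    · right
      refine intGL_smul_ray_iff.2 ⟨rfl, ?_⟩
      rw [pow_one] at hc ⊢
      exact (unif_irreducible F).prime.dvd_of_dvd_pow hc
  · left
    have hcu : IsUnit (k 1 0) := by
      by_contra h
      have : k 0 0 * k 1 1 - k 0 1 * k 1 0 ∈ IsLocalRing.maximalIdeal 𝒪[F] :=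
        sub_mem (Ideal.mul_mem_right _ _ hu) (Ideal.mul_mem_left _ _ h)
      exact this hd
    have hn : n = 0 := by
      by_contra h
      exact (unif_irreducible F).not_isUnit
        (isUnit_of_dvd_unit ((dvd_pow_self _ h).trans hc) (hcu.pow 2))
    rw [hn, ray_zero, intGL_smul_baseVertex]

/-- The normalizer permutes the fixed vertices of the Iwahori subgroup, which are exactly the two
ends of the standard edge. Conversely, whatever preserves this edge normalizes its pointwise
stabilizer. -/
theorem mem_iwahoriNormalizer_iff {g : PGL(2, F)} :
    g ∈ iwahoriNormalizer F ↔ (g • ray F 0 = ray F 0 ∧ g • ray F 1 = ray F 1) ∨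
      (g • ray F 0 = ray F 1 ∧ g • ray F 1 = ray F 0) := by
  rw [iwahoriNormalizer, Subgroup.mem_normalizer_iff]
  have hne : ray F 0 ≠ ray F 1 := fun h => zero_ne_one (ray_injective h)
  constructor
  · intro h
    have key : ∀ i, i ≤ 1 → g • ray F i = ray F 0 ∨ g • ray F i = ray F 1 := by
      intro i hi
      refine eq_ray_of_iwahori_fixed fun x hx => ?_
      have hx' : g⁻¹ * x * g ∈ iwahori F := by
        refine (h _).2 ?_
        convert! hx using 1
        group
      rw [mem_iwahori_iff] at hx'
      have : (g⁻¹ * x * g) • ray F i = ray F i := by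
        interval_cases i
        exacts [hx'.1, hx'.2]
      rwa [mul_smul, mul_smul, inv_smul_eq_iff] at this
    have hne' : g • ray F 0 ≠ g • ray F 1 := fun h => hne (smul_left_cancel g h)
    rcases key 0 zero_le_one with h0 | h0 <;> rcases key 1 le_rfl with h1 | h1
    · exact absurd (h0.trans h1.symm) hne'
    · exact Or.inl ⟨h0, h1⟩
    · exact Or.inr ⟨h0, h1⟩
    · exact absurd (h0.trans h1.symm) hne'
  · intro h x
    rw [mem_iwahori_iff, mem_iwahori_iff]
    rcases h with ⟨h0, h1⟩ | ⟨h0, h1⟩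
    · have h0' := inv_smul_eq_iff.2 h0.symm
      have h1' := inv_smul_eq_iff.2 h1.symm
      simp only [mul_smul, h0', h1', ← eq_inv_smul_iff]
    · have h0' := inv_smul_eq_iff.2 h0.symm
      have h1' := inv_smul_eq_iff.2 h1.symm
      simp [mul_smul, smul_eq_iff_eq_inv_smul g, h0', h1', and_comm]

variable (F) in
/-- The oriented edges of the standard ray. -/
def rayDart (n : ℕ) : (tree F).Dart := ⟨(ray F n, ray F (n + 1)), isEdge_ray n⟩

omit [TopologicalSpace F] [IsNonarchimedeanLocalField F] in
theorem smul_symm (g : PGL(2, F)) (a : (tree F).Dart) : (g • a).symm = g • a.symm := rfl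

omit [TopologicalSpace F] [IsNonarchimedeanLocalField F] in
theorem dart_ext {a b : (tree F).Dart} (h1 : a.fst = b.fst) (h2 : a.snd = b.snd) : a = b :=
  SimpleGraph.Dart.ext _ _ (Prod.ext h1 h2)

theorem exists_smul_rayDart_zero (a : (tree F).Dart) : ∃ g : PGL(2, F), g • rayDart F 0 = a := by
  obtain ⟨g, h0, h1⟩ := IsEdge.exists_smul_ray a.adj
  exact ⟨g, dart_ext h0 h1⟩

theorem mem_iwahoriNormalizer_iff_smul_rayDart {g : PGL(2, F)} :
    g ∈ iwahoriNormalizer F ↔ g • rayDart F 0 = rayDart F 0 ∨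
      g • rayDart F 0 = (rayDart F 0).symm := by
  rw [mem_iwahoriNormalizer_iff]
  exact or_congr ⟨fun h => dart_ext h.1 h.2, fun h => ⟨congrArg (fun a => a.fst) h,
    congrArg (fun a => a.snd) h⟩⟩ ⟨fun h => dart_ext h.1 h.2, fun h =>
      ⟨congrArg (fun a => a.fst) h, congrArg (fun a => a.snd) h⟩⟩

end Iwahori

/-! ### Potentials on the vertices and their limits at the ends of the tree. -/

section Primitive

variable {F : Type*} [Field F] [ValuativeRel F] [TopologicalSpace F]
  [IsNonarchimedeanLocalField F]

theorem intGL_smul_ray_eq_iff {k k' : GL (Fin 2) 𝒪[F]} {m n : ℕ} :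
    intGL F k • ray F n = intGL F k' • ray F m ↔ n = m ∧ unif F ^ n ∣ (k'⁻¹ * k) 1 0 := by
  rw [← inv_smul_eq_iff, ← mul_smul, ← map_inv, ← map_mul, intGL_smul_ray_iff]

/-- Divisibility by `ϖⁿ` implies divisibility by lower powers. In the tree: a vertex determines the
path joining it to the base vertex, so sums along this path do not depend on `vertexRep`. -/
theorem intGL_smul_ray_eq_of_le {k k' : GL (Fin 2) 𝒪[F]} {i n : ℕ}
    (h : intGL F k • ray F n = intGL F k' • ray F n) (hi : i ≤ n) :
    intGL F k • ray F i = intGL F k' • ray F i :=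
  intGL_smul_ray_eq_iff.2 ⟨rfl, (pow_dvd_pow _ hi).trans (intGL_smul_ray_eq_iff.1 h).2⟩

/-- An element of `GL(2, 𝒪)` moving a vertex of the standard ray to `v`. -/
def vertexRep (v : Vertex F) : GL (Fin 2) 𝒪[F] := (exists_eq_intGL_smul_ray v).choose

/-- The distance of `v` to the base vertex. -/
def level (v : Vertex F) : ℕ := (exists_eq_intGL_smul_ray v).choose_spec.choose

theorem vertexRep_smul_ray (v : Vertex F) : intGL F (vertexRep v) • ray F (level v) = v :=
  (exists_eq_intGL_smul_ray v).choose_spec.choose_spec.symm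

theorem level_intGL_smul_ray (k : GL (Fin 2) 𝒪[F]) (n : ℕ) :
    level (intGL F k • ray F n) = n :=
  (intGL_smul_ray_eq_iff.1 (vertexRep_smul_ray (intGL F k • ray F n))).1

theorem finite_level_le (n : ℕ) : {v : Vertex F | level v ≤ n}.Finite := by
  induction n with
  | zero =>
    refine (Set.finite_singleton (baseVertex F)).subset fun v hv => ?_
    rw [Set.mem_singleton_iff, ← vertexRep_smul_ray v, Nat.le_zero.1 hv, ray_zero,
      intGL_smul_baseVertex]
  | succ n ih =>
    refine (ih.union (ih.biUnion fun v _ => finite_neighbors v)).subset fun v hv => ?_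
    rcases Nat.lt_or_ge n (level v) with h | h
    · right
      have hl : level v = n + 1 := le_antisymm hv h
      refine Set.mem_biUnion (x := intGL F (vertexRep v) • ray F n)
        (level_intGL_smul_ray _ _).le ?_
      have := (isEdge_ray (F := F) n).smul (intGL F (vertexRep v))
      rwa [← hl, vertexRep_smul_ray] at this
    · exact Or.inl h

/-- The sum of a function on the oriented edges over the paths starting at the base vertex. -/
def primitive : ((tree F).Dart →₀ ℂ) →ₗ[ℂ] (Vertex F → ℂ) where
  toFun φ v := ∑ i ∈ Finset.range (level v), φ (intGL F (vertexRep v) • rayDart F i)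
  map_add' φ ψ := by
    ext v
    simp [Finset.sum_add_distrib]
  map_smul' c φ := by
    ext v
    simp [Finset.mul_sum]

theorem primitive_intGL_smul_ray (φ : (tree F).Dart →₀ ℂ) (k : GL (Fin 2) 𝒪[F]) (n : ℕ) :
    primitive φ (intGL F k • ray F n) =
      ∑ i ∈ Finset.range n, φ (intGL F k • rayDart F i) := by
  change ∑ i ∈ Finset.range (level _), φ _ = _
  have h := vertexRep_smul_ray (intGL F k • ray F n)
  rw [level_intGL_smul_ray] at h ⊢
  refine Finset.sum_congr rfl fun i hi => congrArg _ ?_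
  rw [Finset.mem_range] at hi
  exact dart_ext (intGL_smul_ray_eq_of_le h hi.le) (intGL_smul_ray_eq_of_le h hi)

/-- Every edge, up to orientation, is the last step of a path from the base vertex, where the two
path sums differ by one term. Antisymmetry settles the edges pointing inwards. -/
theorem primitive_snd_sub_fst {φ : (tree F).Dart →₀ ℂ} (hφ : ∀ a, φ a.symm = -φ a)
    (a : (tree F).Dart) : primitive φ a.snd - primitive φ a.fst = φ a := by
  have key : ∀ k n, primitive φ (intGL F k • ray F (n + 1)) - primitive φ (intGL F k • ray F n) =
      φ (intGL F k • rayDart F n) := by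
    intro k n
    rw [primitive_intGL_smul_ray, primitive_intGL_smul_ray, Finset.sum_range_succ,
      add_sub_cancel_left]
  obtain ⟨k, n, ⟨h1, h2⟩ | ⟨h1, h2⟩⟩ := IsEdge.exists_intGL a.adj
  · have ha : intGL F k • rayDart F n = a := dart_ext h1.symm h2.symm
    rw [← ha]
    exact key k n
  · have ha : intGL F k • rayDart F n = a.symm := dart_ext h1.symm h2.symm
    have := key k n
    rw [ha, hφ] at this
    change a.snd = _ at h1
    change a.fst = _ at h2
    rw [h1, h2]
    linear_combination -this

/-- A function on the vertices with vanishing coboundary is constant. -/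
theorem eq_baseVertex_of_coboundary_eq_zero {h : Vertex F → ℂ}
    (hh : ∀ a : (tree F).Dart, h a.snd - h a.fst = 0) (v : Vertex F) : h v = h (baseVertex F) := by
  obtain ⟨k, n, rfl⟩ := exists_eq_intGL_smul_ray v
  induction n with
  | zero => rw [ray_zero, intGL_smul_baseVertex]
  | succ n ih => rw [← ih, ← sub_eq_zero]; exact hh (intGL F k • rayDart F n)

theorem exists_eq_add_of_coboundary_eq {h h' : Vertex F → ℂ}
    (hh : ∀ a : (tree F).Dart, h a.snd - h a.fst = h' a.snd - h' a.fst) :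
    ∃ c, ∀ v, h v = h' v + c := by
  refine ⟨h (baseVertex F) - h' (baseVertex F), fun v => ?_⟩
  have := eq_baseVertex_of_coboundary_eq_zero (h := fun v => h v - h' v)
    (fun a => by linear_combination hh a) v
  linear_combination this

omit [TopologicalSpace F] [IsNonarchimedeanLocalField F] in
/-- The function `a ↦ φ a - φ ā`. -/
def antisymmetrize : ((tree F).Dart →₀ ℂ) →ₗ[ℂ] ((tree F).Dart →₀ ℂ) :=
  LinearMap.id - (Finsupp.domLCongr (M := ℂ) (R := ℂ) (SimpleGraph.Dart.symm_involutive.toPerm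
    (SimpleGraph.Dart.symm : (tree F).Dart → (tree F).Dart))).toLinearMap

omit [TopologicalSpace F] [IsNonarchimedeanLocalField F] in
theorem antisymmetrize_apply (φ : (tree F).Dart →₀ ℂ) (a : (tree F).Dart) :
    antisymmetrize φ a = φ a - φ a.symm := rfl

omit [TopologicalSpace F] [IsNonarchimedeanLocalField F] in
theorem antisymmetrize_symm (φ : (tree F).Dart →₀ ℂ) (a : (tree F).Dart) :
    antisymmetrize φ a.symm = -antisymmetrize φ a := by
  rw [antisymmetrize_apply, antisymmetrize_apply, SimpleGraph.Dart.symm_symm, neg_sub]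

theorem primitive_antisymmetrize_snd_sub_fst (φ : (tree F).Dart →₀ ℂ) (a : (tree F).Dart) :
    primitive (antisymmetrize φ) a.snd - primitive (antisymmetrize φ) a.fst =
      φ a - φ a.symm :=
  primitive_snd_sub_fst (antisymmetrize_symm φ) a

/-! ### Boundary values -/

omit [TopologicalSpace F] [IsNonarchimedeanLocalField F] in
/-- The function `h` on the vertices is constant on all but finitely many edges. -/
def IsAlmostConstant (h : Vertex F → ℂ) : Prop :=
  {a : (tree F).Dart | h a.snd - h a.fst ≠ 0}.Finite

theorem isAlmostConstant_primitive (φ : (tree F).Dart →₀ ℂ) :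
    IsAlmostConstant (primitive (antisymmetrize φ)) := by
  refine (antisymmetrize φ).support.finite_toSet.subset fun a ha => ?_
  rw [Set.mem_ofPred_eq, primitive_antisymmetrize_snd_sub_fst] at ha
  exact Finsupp.mem_support_iff.2 ha

/-- The value of `h` at the end `g⁻¹ ∞`, where `∞` is the end of the standard ray. -/
def boundaryValue (h : Vertex F → ℂ) (g : PGL(2, F)) : ℂ :=
  Filter.limUnder Filter.atTop fun n => h (g⁻¹ • ray F n)

theorem boundaryValue_eq {h : Vertex F → ℂ} {g : PGL(2, F)} {c : ℂ}
    (hc : ∀ᶠ n in Filter.atTop, h (g⁻¹ • ray F n) = c) : boundaryValue h g = c :=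
  (tendsto_const_nhds.congr' (hc.mono fun _ hn => hn.symm)).limUnder_eq

/-- The edges of a translated ray are distinct, so only finitely many of them are exceptional for
`h`. Hence the limit is an eventual value. -/
theorem IsAlmostConstant.eventually_eq {h : Vertex F → ℂ} (hh : IsAlmostConstant h)
    (g : PGL(2, F)) : ∀ᶠ n in Filter.atTop, h (g⁻¹ • ray F n) = boundaryValue h g := by
  have hinj : Function.Injective fun n => g⁻¹ • rayDart F n := fun n m hnm =>
    ray_injective (smul_left_cancel g⁻¹ (congrArg (fun a => a.fst) hnm))
  have hfin := (hh.preimage hinj.injOn).eventually_cofinite_notMem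
  rw [Nat.cofinite_eq_atTop, Filter.eventually_atTop] at hfin
  obtain ⟨N, hN⟩ := hfin
  have hev : ∀ n ≥ N, h (g⁻¹ • ray F n) = h (g⁻¹ • ray F N) := by
    intro n hn
    induction n, hn using Nat.le_induction with
    | base => rfl
    | succ n hn ih =>
      have h2 := hN n hn
      simp only [Set.mem_preimage, Set.mem_ofPred_eq, not_not] at h2
      rw [← ih, ← sub_eq_zero]
      exact h2
  have hev' := Filter.eventually_atTop.2 ⟨N, hev⟩
  rwa [boundaryValue_eq hev']

/-- An element of the Borel subgroup translates the far part of the standard ray along itself, so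
both limits are taken over a common tail. -/
theorem boundaryValue_borel_mul {h : Vertex F → ℂ} (hh : IsAlmostConstant h) {b : PGL(2, F)}
    (hb : b ∈ borel F) (g : PGL(2, F)) : boundaryValue h (b * g) = boundaryValue h g := by
  obtain ⟨N, M, hNM⟩ := exists_borel_smul_ray (inv_mem hb)
  obtain ⟨n, h1, h2⟩ := (((Filter.tendsto_add_atTop_nat N).eventually
    (hh.eventually_eq (b * g))).and
    ((Filter.tendsto_add_atTop_nat M).eventually (hh.eventually_eq g))).exists
  rw [← h1, ← h2, mul_inv_rev, mul_smul, hNM]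

omit [TopologicalSpace F] [IsNonarchimedeanLocalField F] in
/-- The set of end points of a set of oriented edges. -/
def endpoints (S : Set (tree F).Dart) : Set (Vertex F) :=
  (fun a => a.fst) '' S ∪ (fun a => a.snd) '' S

omit [TopologicalSpace F] [IsNonarchimedeanLocalField F] in
theorem finite_endpoints {S : Set (tree F).Dart} (hS : S.Finite) : (endpoints S).Finite :=
  (hS.image _).union (hS.image _)

omit [TopologicalSpace F] [IsNonarchimedeanLocalField F] in
theorem smul_eq_of_mem_fixingSubgroup {S : Set (tree F).Dart} {u : PGL(2, F)}
    (hu : u ∈ fixingSubgroup PGL(2, F) (endpoints S)) {a : (tree F).Dart} (ha : a ∈ S) :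
    u • a = a := by
  rw [mem_fixingSubgroup_iff] at hu
  exact dart_ext (hu _ (Or.inl ⟨a, ha, rfl⟩)) (hu _ (Or.inr ⟨a, ha, rfl⟩))

omit [TopologicalSpace F] [IsNonarchimedeanLocalField F] in
/-- A function on the oriented edges is invariant under the elements fixing its support. -/
theorem apply_smul_eq_of_mem_fixingSubgroup {φ : (tree F).Dart → ℂ} {u : PGL(2, F)}
    (hu : u ∈ fixingSubgroup PGL(2, F) (endpoints (Function.support φ))) (a : (tree F).Dart) :
    φ (u • a) = φ a := by
  by_cases ha : a ∈ Function.support φ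
  · rw [smul_eq_of_mem_fixingSubgroup hu ha]
  · by_cases ha' : u • a ∈ Function.support φ
    · have := smul_eq_of_mem_fixingSubgroup (inv_mem hu) ha'
      rw [inv_smul_smul] at this
      rw [← this]
    · rw [Function.notMem_support.1 ha, Function.notMem_support.1 ha']

/-- An element fixing all exceptional edges preserves the coboundary of `h`, so it changes `h` by a
constant only. Fixing the base vertex as well makes this constant zero. -/
theorem exists_isOpen_boundaryValue_mul {h : Vertex F → ℂ} (hh : IsAlmostConstant h) :
    ∃ U : Subgroup PGL(2, F), IsOpen (U : Set PGL(2, F)) ∧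
      ∀ g, ∀ u ∈ U, boundaryValue h (g * u) = boundaryValue h g := by
  set S := Function.support fun a : (tree F).Dart => h a.snd - h a.fst with hS
  refine ⟨fixingSubgroup PGL(2, F) (endpoints S) ⊓ MulAction.stabilizer _ (baseVertex F),
    (isOpen_fixingSubgroup (finite_endpoints hh)).inter (isOpen_stabilizer_vertex _), ?_⟩
  rintro g u ⟨hu, hu'⟩
  have h1 : ∀ v, h (u⁻¹ • v) = h v := by
    intro v
    obtain ⟨c, hc⟩ := exists_eq_add_of_coboundary_eq (h := fun v => h (u⁻¹ • v)) (h' := h)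
      (fun a => apply_smul_eq_of_mem_fixingSubgroup (inv_mem hu) a)
    have h2 := hc (baseVertex F)
    have h3 : u⁻¹ • baseVertex F = baseVertex F :=
      (MulAction.stabilizer PGL(2, F) (baseVertex F)).inv_mem hu'
    simp only [h3] at h2
    rw [hc, show c = 0 by linear_combination -h2, add_zero]
  rw [boundaryValue, mul_inv_rev]
  simp only [mul_smul, h1]
  rfl

theorem boundaryValue_mem {h : Vertex F → ℂ} (hh : IsAlmostConstant h) :
    boundaryValue h ∈ (borelInd F).toSubmodule :=
  ⟨fun b g => boundaryValue_borel_mul hh b.2 g, exists_isOpen_boundaryValue_mul hh⟩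

/-- Beyond the levels of the exceptional edges, `h` is constant along every outward ray, so each
vertex there already carries a boundary value. -/
theorem finite_ne_of_boundaryValue_eq {h : Vertex F → ℂ} (hh : IsAlmostConstant h) {c : ℂ}
    (hc : ∀ g, boundaryValue h g = c) : {v | h v ≠ c}.Finite := by
  obtain ⟨N, hN⟩ := ((finite_endpoints hh).image level).bddAbove
  refine (finite_level_le N).subset fun v hv => ?_
  by_contra hlt
  rw [Set.mem_ofPred_eq, not_le] at hlt
  apply hv
  rw [← vertexRep_smul_ray v]
  set k := vertexRep v
  set n := level v
  have hev : ∀ m ≥ n, h (intGL F k • ray F m) = h (intGL F k • ray F n) := by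
    intro m hm
    induction m, hm using Nat.le_induction with
    | base => rfl
    | succ m hm ih =>
      rw [← ih, ← sub_eq_zero]
      by_contra hne
      have h1 := hN ⟨_, Or.inl ⟨intGL F k • rayDart F m, hne, rfl⟩, rfl⟩
      change level (intGL F k • ray F m) ≤ N at h1
      rw [level_intGL_smul_ray] at h1
      omega
  have h2 := boundaryValue_eq (h := h) (g := (intGL F k)⁻¹) (c := h (intGL F k • ray F n))
    (by rw [inv_inv]; exact Filter.eventually_atTop.2 ⟨n, hev⟩)
  rw [← h2, hc]

/-- Every function in `Ind_B^G 𝟏` is a boundary value. -/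
theorem exists_boundaryValue_eq {Φ : PGL(2, F) → ℂ} (hΦ : Φ ∈ (borelInd F).toSubmodule) :
    ∃ h : Vertex F → ℂ, IsAlmostConstant h ∧ boundaryValue h = Φ := by
  obtain ⟨hB, U, hU, hΦU⟩ := hΦ
  replace hB : ∀ b ∈ borel F, ∀ g, Φ (b * g) = Φ g := fun b hb g => hB ⟨b, hb⟩ g
  obtain ⟨N, hN⟩ := exists_congruenceSubgroup_le hU
  -- Far out, a vertex determines `Φ` on the ends behind it. The bound is `N + 1` because
  -- `eq_of_smul_ray_eq` needs a nonzero level; the values further in do not affect the limits.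
  let h : Vertex F → ℂ := fun v => if N + 1 ≤ level v then Φ (intGL F (vertexRep v))⁻¹ else 0
  have hh : ∀ k, ∀ n ≥ N + 1, h (intGL F k • ray F n) = Φ (intGL F k)⁻¹ := by
    intro k n hn
    have h1 := vertexRep_smul_ray (intGL F k • ray F n)
    simp only [h]
    rw [level_intGL_smul_ray] at h1 ⊢
    rw [if_pos hn]
    exact eq_of_smul_ray_eq hB hΦU (by omega) (hN n (by omega)) h1
  have hfin : IsAlmostConstant h := by
    have hf := (finite_level_le (F := F) (N + 1)).prod (finite_level_le (F := F) (N + 1))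
    refine (hf.preimage SimpleGraph.Dart.toProd_injective.injOn).subset fun a ha => ?_
    obtain ⟨k, n, hkn⟩ := IsEdge.exists_intGL a.adj
    have hn : n < N + 1 := by
      by_contra hn
      apply ha
      rcases hkn with ⟨h1, h2⟩ | ⟨h1, h2⟩
      · change a.fst = _ at h1
        change a.snd = _ at h2
        rw [h1, h2, hh _ _ (by omega), hh _ _ (by omega), sub_self]
      · change a.snd = _ at h1
        change a.fst = _ at h2
        rw [h1, h2, hh _ _ (by omega), hh _ _ (by omega), sub_self]
    change level a.fst ≤ N + 1 ∧ level a.snd ≤ N + 1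
    rcases hkn with ⟨h1, h2⟩ | ⟨h1, h2⟩
    · change a.fst = _ at h1
      change a.snd = _ at h2
      rw [h1, h2, level_intGL_smul_ray, level_intGL_smul_ray]
      omega
    · change a.snd = _ at h1
      change a.fst = _ at h2
      rw [h1, h2, level_intGL_smul_ray, level_intGL_smul_ray]
      omega
  refine ⟨h, hfin, funext fun g => ?_⟩
  -- By the Iwasawa decomposition, the ray towards an arbitrary end has the same tail as a ray `k •
  -- ray n`, where `h` is known.
  obtain ⟨k, b, hb, hkb⟩ := exists_intGL_mul_borel g⁻¹
  obtain ⟨M, L, hML⟩ := exists_borel_smul_ray hb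
  obtain ⟨n, hn, hnN⟩ := (((Filter.tendsto_add_atTop_nat M).eventually
    (hfin.eventually_eq g)).and (Filter.eventually_ge_atTop (N + 1))).exists
  rw [← hn, hkb, mul_smul, hML, hh _ _ (by omega)]
  have hg : g = b⁻¹ * (intGL F k)⁻¹ := by rw [← mul_inv_rev, ← hkb, inv_inv]
  rw [hg, hB _ (inv_mem hb)]

end Primitive

/-! ### The decomposition map on cochains, its image and its kernel. -/

section Decomposition

variable {F : Type*} [Field F] [ValuativeRel F] [TopologicalSpace F]
  [IsNonarchimedeanLocalField F]

variable (F) in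
/-- The boundary value of the primitive of the antisymmetrization of a cochain. -/
def cochainToBorelInd : ((tree F).Dart →₀ ℂ) →ₗ[ℂ] (borelInd F).toSubmodule where
  toFun φ := ⟨boundaryValue (primitive (antisymmetrize φ)),
    boundaryValue_mem (isAlmostConstant_primitive φ)⟩
  map_add' φ ψ := by
    refine Subtype.ext (funext fun g => boundaryValue_eq ?_)
    filter_upwards [(isAlmostConstant_primitive φ).eventually_eq g,
      (isAlmostConstant_primitive ψ).eventually_eq g] with n h1 h2
    rw [map_add, map_add, Pi.add_apply, h1, h2]
    rfl
  map_smul' c φ := by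
    refine Subtype.ext (funext fun g => boundaryValue_eq ?_)
    filter_upwards [(isAlmostConstant_primitive φ).eventually_eq g] with n h1
    rw [map_smul, map_smul, Pi.smul_apply, h1]
    rfl

theorem cochainToBorelInd_apply (φ : (tree F).Dart →₀ ℂ) (g : PGL(2, F)) :
    (cochainToBorelInd F φ).1 g = boundaryValue (primitive (antisymmetrize φ)) g := rfl

/-- Potentials with the same coboundary differ by a constant, so modulo constants any potential may
replace `primitive`. Equivariance, surjectivity and vanishing on coboundaries all follow by choosing
a suitable `h`. -/
theorem cochainToBorelInd_sub_mem_constants {φ : (tree F).Dart →₀ ℂ} {h : Vertex F → ℂ}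
    (hφ : ∀ a : (tree F).Dart, φ a - φ a.symm = h a.snd - h a.fst) {f : (borelInd F).toSubmodule}
    (hf : ∀ g, ∀ᶠ n in Filter.atTop, h (g⁻¹ • ray F n) = f.1 g) :
    cochainToBorelInd F φ - f ∈ constants F := by
  obtain ⟨c, hc⟩ := exists_eq_add_of_coboundary_eq (h := primitive (antisymmetrize φ)) (h' := h)
    fun a => (primitive_antisymmetrize_snd_sub_fst φ a).trans (hφ a)
  refine ⟨c, fun g => ?_⟩
  change (cochainToBorelInd F φ).1 g - f.1 g = c
  rw [sub_eq_iff_eq_add', cochainToBorelInd_apply]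
  apply boundaryValue_eq
  filter_upwards [hf g] with n hn
  rw [hc, hn]

theorem cochainToBorelInd_permRep (x : PGL(2, F)) (φ : (tree F).Dart →₀ ℂ) :
    cochainToBorelInd F (permRep PGL(2, F) (tree F).Dart x φ) -
      (borelInd F).toRepresentation x (cochainToBorelInd F φ) ∈ constants F := by
  refine cochainToBorelInd_sub_mem_constants
    (h := fun v => primitive (antisymmetrize φ) (x⁻¹ • v)) (fun a => ?_) fun g => ?_
  · exact (primitive_antisymmetrize_snd_sub_fst φ (x⁻¹ • a)).symm
  · have := (isAlmostConstant_primitive φ).eventually_eq (g * x)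
    simp only [mul_inv_rev, mul_smul] at this
    exact this

variable (F) in
/-- The symmetrization of a cochain as a function on the group. -/
def cochainToCInd : ((tree F).Dart →₀ ℂ) →ₗ[ℂ] (cInd (iwahoriNormalizer F)
    (Representation.trivial ℂ (iwahoriNormalizer F) ℂ)).toSubmodule where
  toFun φ := ⟨fun g => φ (g⁻¹ • rayDart F 0) + φ (g⁻¹ • (rayDart F 0).symm), by
    refine ⟨⟨fun x g => ?_, fixingSubgroup PGL(2, F) (endpoints (Function.support φ)),
      isOpen_fixingSubgroup (finite_endpoints φ.hasFiniteSupport), fun g u hu => ?_⟩, ?_⟩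
    · rw [Representation.trivial_apply]
      beta_reduce
      rw [mul_inv_rev, mul_smul, mul_smul]
      rcases mem_iwahoriNormalizer_iff_smul_rayDart.1 (inv_mem x.2) with h | h
      · rw [← smul_symm (x : PGL(2, F))⁻¹, h]
      · rw [← smul_symm (x : PGL(2, F))⁻¹, h, SimpleGraph.Dart.symm_symm, add_comm]
    · beta_reduce
      rw [mul_inv_rev, mul_smul, mul_smul]
      congr 1 <;> exact apply_smul_eq_of_mem_fixingSubgroup (inv_mem hu) _
    · choose γ hγ using exists_smul_rayDart_zero (F := F)
      -- A finite set suffices as the compact set: one group element for each oriented edge in the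
      -- support.
      refine ⟨(fun a => (γ a)⁻¹) '' Function.support φ, (φ.hasFiniteSupport.image _).isCompact, ?_⟩
      intro g hg
      have key : ∃ a ∈ Function.support φ, g * γ a ∈ iwahoriNormalizer F := by
        by_cases h1 : φ (g⁻¹ • rayDart F 0) = 0
        · refine ⟨g⁻¹ • (rayDart F 0).symm, fun h2 => hg ?_,
            mem_iwahoriNormalizer_iff_smul_rayDart.2 (Or.inr ?_)⟩
          · change φ (g⁻¹ • rayDart F 0) + φ (g⁻¹ • (rayDart F 0).symm) = 0
            rw [h1, h2, add_zero]
          · rw [mul_smul, hγ, smul_inv_smul]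
        · refine ⟨_, h1, mem_iwahoriNormalizer_iff_smul_rayDart.2 (Or.inl ?_)⟩
          rw [mul_smul, hγ, smul_inv_smul]
      obtain ⟨a, ha, hga⟩ := key
      exact ⟨g * γ a, hga, _, ⟨a, ha, rfl⟩, mul_inv_cancel_right _ _⟩⟩
  map_add' φ ψ := by
    refine Subtype.ext (funext fun g => ?_)
    change (φ + ψ) _ + (φ + ψ) _ = φ _ + φ _ + (ψ _ + ψ _)
    rw [Finsupp.add_apply, Finsupp.add_apply]
    ring
  map_smul' c φ := by
    refine Subtype.ext (funext fun g => ?_)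
    change (c • φ) _ + (c • φ) _ = c * (φ _ + φ _)
    rw [Finsupp.smul_apply, Finsupp.smul_apply, smul_eq_mul, smul_eq_mul, mul_add]

theorem cochainToCInd_apply (φ : (tree F).Dart →₀ ℂ) (g : PGL(2, F)) :
    (cochainToCInd F φ).1 g = φ (g⁻¹ • rayDart F 0) + φ (g⁻¹ • (rayDart F 0).symm) := rfl

theorem cochainToCInd_permRep (x : PGL(2, F)) (φ : (tree F).Dart →₀ ℂ) :
    cochainToCInd F (permRep PGL(2, F) (tree F).Dart x φ) =
      (cInd (iwahoriNormalizer F) (Representation.trivial ℂ (iwahoriNormalizer F)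
        ℂ)).toRepresentation x (cochainToCInd F φ) := by
  refine Subtype.ext (funext fun g => ?_)
  change φ (x⁻¹ • g⁻¹ • _) + φ (x⁻¹ • g⁻¹ • _) =
    φ ((g * x)⁻¹ • _) + φ ((g * x)⁻¹ • _)
  rw [mul_inv_rev, mul_smul, mul_smul]

theorem cochainToCInd_eq_zero_iff {φ : (tree F).Dart →₀ ℂ} :
    cochainToCInd F φ = 0 ↔ ∀ a, φ a.symm = -φ a := by
  constructor
  · intro h a
    obtain ⟨g, rfl⟩ := exists_smul_rayDart_zero a
    have : (cochainToCInd F φ).1 g⁻¹ = 0 := by rw [h]; rfl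
    rw [cochainToCInd_apply, inv_inv] at this
    rw [smul_symm]
    linear_combination this
  · intro h
    refine Subtype.ext (funext fun g => ?_)
    rw [cochainToCInd_apply, ← smul_symm, h]
    exact add_neg_cancel _

/-- A function in `c-Ind 𝟏` has finite support as a function on the oriented edges. -/
theorem finite_setOf_apply_ne_zero {f : PGL(2, F) → ℂ} {C : Set PGL(2, F)} (hC : IsCompact C)
    (hfC : Function.support f ⊆ (iwahoriNormalizer F : Set PGL(2, F)) * C)
    (γ : (tree F).Dart → PGL(2, F)) (hγ : ∀ a, γ a • rayDart F 0 = a) :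
    {a | f (γ a)⁻¹ ≠ 0}.Finite := by
  let U : Subgroup PGL(2, F) := fixingSubgroup PGL(2, F) (endpoints {rayDart F 0})
  have hU : IsOpen (U : Set PGL(2, F)) :=
    isOpen_fixingSubgroup (finite_endpoints (Set.finite_singleton _))
  -- Finitely many cosets `U * c` cover `C`, and on each of them the edge `c⁻¹ • rayDart F 0` is
  -- constant.
  obtain ⟨t, -, ht⟩ := hC.elim_nhds_subcover (fun c => (fun x => x * c⁻¹) ⁻¹' U)
    fun c _ => (hU.preimage (by fun_prop)).mem_nhds (by simp [U.one_mem])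
  refine ((t.finite_toSet.image fun c => c⁻¹ • rayDart F 0).union
    (t.finite_toSet.image fun c => c⁻¹ • (rayDart F 0).symm)).subset fun a ha => ?_
  obtain ⟨x, hx, c, hc, hxc⟩ := hfC ha
  obtain ⟨c', hc', hcc'⟩ := Set.mem_iUnion₂.1 (ht hc)
  have h1 : c⁻¹ • rayDart F 0 = c'⁻¹ • rayDart F 0 := by
    have := smul_eq_of_mem_fixingSubgroup (inv_mem (show c * c'⁻¹ ∈ U from hcc'))
      (Set.mem_singleton (rayDart F 0))
    rwa [mul_inv_rev, inv_inv, mul_smul, ← eq_inv_smul_iff] at this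
  have ha' : a = c⁻¹ • x⁻¹ • rayDart F 0 := by
    rw [← mul_smul, ← mul_inv_rev, show x * c = (γ a)⁻¹ from hxc, inv_inv, hγ]
  rcases mem_iwahoriNormalizer_iff_smul_rayDart.1 (inv_mem hx) with h | h
  · exact Or.inl ⟨c', hc', by rw [ha', h, h1]⟩
  · exact Or.inr ⟨c', hc', by beta_reduce; rw [ha', h, ← smul_symm, ← smul_symm, h1]⟩

/-- Every function in `c-Ind 𝟏` is the image of a symmetric cochain. -/
theorem exists_cochainToCInd_eq (f : (cInd (iwahoriNormalizer F)
    (Representation.trivial ℂ (iwahoriNormalizer F) ℂ)).toSubmodule) :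
    ∃ φ, cochainToCInd F φ = f ∧ ∀ a, φ a.symm = φ a := by
  obtain ⟨f, ⟨hI, -⟩, C, hC, hfC⟩ := f
  choose γ hγ using exists_smul_rayDart_zero (F := F)
  have hfin := finite_setOf_apply_ne_zero hC hfC γ hγ
  have key : ∀ (g : PGL(2, F)) (a : (tree F).Dart),
      g⁻¹ • rayDart F 0 = a ∨ g⁻¹ • (rayDart F 0).symm = a → f (γ a)⁻¹ = f g := by
    intro g a h
    have hm : g * γ a ∈ iwahoriNormalizer F := by
      rw [mem_iwahoriNormalizer_iff_smul_rayDart, mul_smul, hγ]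
      rcases h with rfl | rfl
      · exact Or.inl (smul_inv_smul _ _)
      · exact Or.inr (smul_inv_smul _ _)
    have h1 : f (g * γ a * (γ a)⁻¹) = f (γ a)⁻¹ := hI ⟨_, hm⟩ _
    rw [← h1, mul_inv_cancel_right]
  -- The factor `1/2` compensates for `cochainToCInd` adding the values on both orientations.
  let φ : (tree F).Dart →₀ ℂ := Finsupp.ofSupportFinite (fun a => f (γ a)⁻¹ / 2)
    (hfin.subset fun a ha h => ha (by simp [h]))
  have hφ : ∀ (g : PGL(2, F)) (a : (tree F).Dart),
      g⁻¹ • rayDart F 0 = a ∨ g⁻¹ • (rayDart F 0).symm = a → φ a = f g / 2 :=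
    fun g a h => congrArg (· / 2) (key g a h)
  refine ⟨φ, Subtype.ext (funext fun g => ?_), fun a => ?_⟩
  · rw [cochainToCInd_apply, hφ g _ (Or.inl rfl), hφ g _ (Or.inr rfl), add_halves]
  · rw [hφ (γ a)⁻¹ a (Or.inl (by rw [inv_inv, hγ])), hφ (γ a)⁻¹ a.symm (Or.inr (by
      rw [inv_inv, ← smul_symm, hγ]))]

variable (F) in
/-- The map on cochains inducing the decomposition of the cohomology. -/
def cochainMap : ((tree F).Dart →₀ ℂ) →ₗ[ℂ] ((borelInd F).toSubmodule ⧸ constants F) ×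
    (cInd (iwahoriNormalizer F)
      (Representation.trivial ℂ (iwahoriNormalizer F) ℂ)).toSubmodule :=
  ((constants F).mkQ.comp (cochainToBorelInd F)).prod (cochainToCInd F)

theorem cochainMap_surjective : Function.Surjective (cochainMap F) := by
  rintro ⟨q, f⟩
  obtain ⟨Φ, rfl⟩ := (constants F).mkQ_surjective q
  obtain ⟨h, hh, hΦ⟩ := exists_boundaryValue_eq Φ.2
  obtain ⟨ψ, hψ, hsymm⟩ := exists_cochainToCInd_eq f
  -- Halved because antisymmetrizing doubles an antisymmetric cochain. The second component does not
  -- see `φ`, and the first does not see the symmetric `ψ`.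
  let φ : (tree F).Dart →₀ ℂ := Finsupp.ofSupportFinite (fun a => (h a.snd - h a.fst) / 2)
    (hh.subset fun a ha h0 => ha (by simp [h0]))
  have hφ : ∀ a : (tree F).Dart, φ a = (h a.snd - h a.fst) / 2 := fun _ => rfl
  refine ⟨φ + ψ, Prod.ext ?_ ?_⟩
  · change (constants F).mkQ (cochainToBorelInd F (φ + ψ)) = (constants F).mkQ Φ
    rw [Submodule.mkQ_apply, Submodule.mkQ_apply, Submodule.Quotient.eq]
    refine cochainToBorelInd_sub_mem_constants (h := h) (fun a => ?_) fun g => ?_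
    · rw [Finsupp.add_apply, Finsupp.add_apply, hsymm, hφ, hφ]
      change (h a.snd - h a.fst) / 2 + ψ a - ((h a.fst - h a.snd) / 2 + ψ a) = _
      ring
    · rw [← hΦ]
      exact hh.eventually_eq g
  · change cochainToCInd F (φ + ψ) = f
    rw [map_add, hψ, cochainToCInd_eq_zero_iff.2, zero_add]
    intro a
    change (h a.fst - h a.snd) / 2 = -((h a.snd - h a.fst) / 2)
    ring

theorem ker_cochainMap : LinearMap.ker (cochainMap F) = LinearMap.range (coboundary F) := by
  ext φ
  have hker : φ ∈ LinearMap.ker (cochainMap F) ↔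
      cochainToBorelInd F φ ∈ constants F ∧ cochainToCInd F φ = 0 := by
    rw [cochainMap, LinearMap.ker_prod, Submodule.mem_inf, LinearMap.mem_ker, LinearMap.mem_ker,
      LinearMap.comp_apply, Submodule.mkQ_apply, Submodule.Quotient.mk_eq_zero]
  rw [hker, cochainToCInd_eq_zero_iff]
  constructor
  · rintro ⟨⟨c, hc⟩, hφ⟩
    have hfin := finite_ne_of_boundaryValue_eq (isAlmostConstant_primitive φ) hc
    -- Subtracting the common boundary value makes the potential finitely supported; halving is
    -- needed since `φ` is antisymmetric and `antisymmetrize φ` equals `2 φ`.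
    refine ⟨Finsupp.ofSupportFinite (fun v => (primitive (antisymmetrize φ) v - c) / 2)
      (hfin.subset fun v hv h => hv (by simp [h])), Finsupp.ext fun a => ?_⟩
    rw [coboundary_apply, Finsupp.ofSupportFinite_coe]
    have := primitive_antisymmetrize_snd_sub_fst φ a
    rw [hφ] at this
    linear_combination this / 2
  · rintro ⟨f, rfl⟩
    constructor
    · have := cochainToBorelInd_sub_mem_constants (φ := coboundary F f) (h := fun v => 2 * f v)
        (f := 0) (fun a => ?_) fun g => ?_
      · rwa [sub_zero] at this
      · rw [coboundary_apply, coboundary_apply]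
        change f a.snd - f a.fst - (f a.fst - f a.snd) = _
        ring
      · have hinj : Function.Injective fun n => g⁻¹ • ray F n :=
          (MulAction.injective g⁻¹).comp ray_injective
        have := (f.hasFiniteSupport.preimage hinj.injOn).eventually_cofinite_notMem
        rw [Nat.cofinite_eq_atTop] at this
        filter_upwards [this] with n hn
        rw [Function.notMem_support.1 hn, mul_zero]
        rfl
    · intro a
      rw [coboundary_apply, coboundary_apply]
      change f a.fst - f a.snd = _
      ring

end Decomposition

end TreeCohomology

end

theorem mainTheorem6 (F : Type*) [Field F] [ValuativeRel F] [TopologicalSpace F]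
    [IsNonarchimedeanLocalField F] (hF : ringChar 𝓀[F] ≠ 2) :
    Nonempty ((TreeCohomology.cohomology F).Equiv
      ((TreeCohomology.steinberg F).prod
        (TreeCohomology.cInd (TreeCohomology.iwahoriNormalizer F)
          (Representation.trivial ℂ (TreeCohomology.iwahoriNormalizer F) ℂ)).toRepresentation)) := by
  let e := (Submodule.quotEquivOfEq _ _ (TreeCohomology.ker_cochainMap (F := F)).symm).trans
    (LinearMap.quotKerEquivOfSurjective _ TreeCohomology.cochainMap_surjective)
  refine ⟨Representation.Equiv.mk' ⟨e.toLinearMap, fun x => ?_⟩ e.symm e.symm_apply_apply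
    e.apply_symm_apply⟩
  -- Equivariance is checked on cochains. In the first component it is only established modulo
  -- constants, since `primitive` is normalized at the base vertex, which the group moves.
  refine Submodule.linearMap_qext _ (LinearMap.ext fun φ => Prod.ext ?_ ?_)
  · exact (Submodule.Quotient.eq _).2 (TreeCohomology.cochainToBorelInd_permRep x φ)
  · exact TreeCohomology.cochainToCInd_permRep x φ
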